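/- **Proposition 4.1.** Let $J_0(x)=\sum_{k\ge 0}\frac{(-1)^k}{(k!)^2}(x/2)^{2k}$. Let $f:(0,\infty)\to\mathbb R$ be continuous, let $s_0\in\mathbb R$, and suppose that the Laplace transform $F(s)=\int_0^\infty e^{-sy}f(y)\,dy$ converges absolutely for every $s>s_0$. Let $$\varphi=\mathcal L_\xi^{-1}\Big[\tfrac12\big(\xi+\tfrac1\xi\big)F\big(\tfrac12(\tfrac1\xi-\xi)\big)\Big],$$ that is, $\varphi:(0,\infty)\to\mathbb R$ is a function such that, for every $\xi>0$ with $\frac12(\frac1\xi-\xi)>s_0$, the integral $\int_0^\infty e^{-\xi\lambda}\varphi(\lambda)\,d\lambda$ converges absolutely and equals $\tfrac12(\xi+\tfrac1\xi)F(\tfrac12(\tfrac1\xi-\xi))$. Put $$u(y,t)=\frac12\int_0^\infty\varphi(\lambda)\Big[J_0\big(\sqrt{y^2+2\lambda y e^{t}}\big)+J_0\big(\sqrt{y^2+2\lambda y e^{-t}}\big)\Big]d\lambda,\qquad y>0,\ t\in\mathbb R,$$ and suppose that this integral converges absolutely for all $y>0$ and $t\ge 0$ (hence, by symmetry, for all $t\in\mathbb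 R$). Then $u$ solves the initial value problem $$u_{tt}=y^2u_{yy}+yu_y+y^2u,\qquad u(y,0)=f(y),\qquad u_t(y,0)=0\qquad(y>0)$$ in the following sense. 1. $u$ is a weak solution: it is continuous on $(0,\infty)\times[0,\infty)$, $u(y,0)=f(y)$ for every $y>0$, and for every $\eta\in C_c^\infty((0,\infty)\times\mathbb R)$ $$\int_0^\infty\!\!\int_0^\infty u\,\big[\eta_{tt}-(y^2\eta)_{yy}+(y\eta)_y-y^2\eta\big]\,dy\,dt=-\int_0^\infty f(y)\,\eta_t(y,0)\,dy .$$ 2. If $u$ is of class $C^2$ on $(0,\infty)\times\mathbb R$, then it is a classical solution: the equation holds at every point of $(0,\infty)\times\mathbb R$, and $u(y,0)=f(y)$, $u_t(y,0)=0$ for every $y>0$. 3. If $\int_0^\infty\lambda^{3/4}|\varphi(\lambda)|\,d\lambda<\infty$, then $u$ is of class $C^2$ on $(0,\infty)\times\mathbb R$ and is a classical solution. -/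

import Mathlib

open Set MeasureTheory

noncomputable section

/-- The Bessel function of the first kind of order zero, by its (everywhere convergent) power
series. -/
def besselJ0 (x : ℝ) : ℝ :=
  ∑' k : ℕ, (-1) ^ k / (k.factorial : ℝ) ^ 2 * (x / 2) ^ (2 * k)

/-- The Laplace integral of `f` at `s` converges (absolutely). -/
def LaplaceConverges (f : ℝ → ℝ) (s : ℝ) : Prop :=
  IntegrableOn (fun y => Real.exp (-(s * y)) * f y) (Ioi 0)

/-- The Laplace transform of a function on the half line. -/
def laplaceTransform (f : ℝ → ℝ) (s : ℝ) : ℝ :=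
  ∫ y in Ioi (0 : ℝ), Real.exp (-(s * y)) * f y

/-- `φ` is an inverse Laplace transform of `G`, where `G` is given on the set `S`: the Laplace
integral of `φ` converges on `S` and its value there is `G`. -/
def IsInverseLaplaceOn (φ G : ℝ → ℝ) (S : Set ℝ) : Prop :=
  ∀ ξ ∈ S, LaplaceConverges φ ξ ∧ laplaceTransform φ ξ = G ξ

/-- The kernel `J₀(√(y² + 2 l y e^t)) + J₀(√(y² + 2 l y e^{-t}))`. -/
def besselKernel (y t l : ℝ) : ℝ :=
  besselJ0 (Real.sqrt (y ^ 2 + 2 * l * y * Real.exp t)) +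
    besselJ0 (Real.sqrt (y ^ 2 + 2 * l * y * Real.exp (-t)))

/-- The function `½ ∫₀^∞ φ(l) [J₀(√(y² + 2 l y e^t)) + J₀(√(y² + 2 l y e^{-t}))] dl`. -/
def besselSolution (φ : ℝ → ℝ) (y t : ℝ) : ℝ :=
  1 / 2 * ∫ l in Ioi (0 : ℝ), φ l * besselKernel y t l

/-- `u` is a classical solution, for `y > 0` and all real `t`, of
`u_tt = y² u_yy + y u_y + y² u`, `u(y,0) = f(y)`, `u_t(y,0) = g(y)`. -/
structure IsClassicalSolution (f g : ℝ → ℝ) (u : ℝ → ℝ → ℝ) : Prop where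
  contDiffOn : ContDiffOn ℝ 2 (fun p : ℝ × ℝ => u p.1 p.2) (Ioi 0 ×ˢ univ)
  equation : ∀ y > 0, ∀ t,
    iteratedDeriv 2 (fun τ => u y τ) t =
      y ^ 2 * iteratedDeriv 2 (fun z => u z t) y + y * deriv (fun z => u z t) y + y ^ 2 * u y t
  initial_value : ∀ y > 0, u y 0 = f y
  initial_velocity : ∀ y > 0, HasDerivAt (fun t => u y t) (g y) 0

/-- `u` is a continuous weak solution, for `y > 0` and `t ≥ 0`, of
`u_tt = y² u_yy + y u_y + y² u`, `u(y,0) = f(y)`, `u_t(y,0) = g(y)`: the equation and the initial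
velocity are tested against smooth functions `η` with compact support in `(0,∞) × ℝ` (which need
not vanish at `t = 0`), and the formal adjoint of the operator on the right-hand side is
`η ↦ (y² η)_yy - (y η)_y + y² η`. -/
structure IsWeakSolution (f g : ℝ → ℝ) (u : ℝ → ℝ → ℝ) : Prop where
  continuousOn : ContinuousOn (fun p : ℝ × ℝ => u p.1 p.2) (Ioi 0 ×ˢ Ici 0)
  initial_value : ∀ y > 0, u y 0 = f y
  equation : ∀ η : ℝ → ℝ → ℝ, ContDiff ℝ (⊤ : ℕ∞) (fun p : ℝ × ℝ => η p.1 p.2) →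
    HasCompactSupport (fun p : ℝ × ℝ => η p.1 p.2) →
    tsupport (fun p : ℝ × ℝ => η p.1 p.2) ⊆ Ioi 0 ×ˢ univ →
    ∫ p in Ioi (0 : ℝ) ×ˢ Ioi (0 : ℝ), u p.1 p.2 *
        (iteratedDeriv 2 (fun τ => η p.1 τ) p.2 -
          (iteratedDeriv 2 (fun z => z ^ 2 * η z p.2) p.1 -
            deriv (fun z => z * η z p.2) p.1 + p.1 ^ 2 * η p.1 p.2)) =
      ∫ y in Ioi (0 : ℝ), (g y * η y 0 - f y * deriv (fun τ => η y τ) 0)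

end

/-!
Write `g z = J₀ (√z) = ∑ (-1)ᵏ / (k!)² (z/4)ᵏ`, an entire function with `z g'' + g' + g / 4 = 0`. In
the coordinates `p = y eᵗ`, `q = y e⁻ᵗ` the equation reads `-4 u_pq = u`, and
`g (y² + 2 l y eᵗ) = g (p q + 2 l p)` solves it for every `l`; so does its reflection in `t`. Hence
each kernel is an even classical solution (`waveOperator_besselWave`), and `u` is a superposition of
such solutions. Everything else is the justification of the limit processes.

* *Decay.* `v = √x J₀(x)` solves `v'' + (1 + 1 / (4 x²)) v = 0`, so its energy is monotone. This
  gives `g = O(z ^ (-1/4))`, and, with the differential equation, `g' = O(z ^ (-3/4))` and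
  `g'' = O(z ^ (-5/4))`.
* *The weight.* The hypothesis only says that `φ` times an oscillating kernel is integrable for each
  `y`. The energy of `v` is also bounded below and is equally shared by `v²` and `v'²` on average, so
  the mean of the modulus of the kernel over almost all of `1 < y ≤ 2` is at least a constant times
  `l ^ (-1/4)`. Averaging over the `y` for which the integral is bounded shows that
  `(1 + l) ^ (-1/4) φ` is integrable (`integrableOn_rpow_mul_of_integrableOn_bessel`). With the decay
  this makes all the integrals below absolutely convergent, locally uniformly in `(y, t)`.
* *Initial value.* `g (y² + 2 l y)` is the constant Laurent coefficient in `w` of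
  `exp (l w + y (w - 1/w) / 2)`. Its Laplace transform in `y` at `s = (1/ξ - ξ) / 2` is therefore an
  integral over the unit circle, which Cauchy's formula evaluates to `exp (-ξ l) / ((ξ + 1/ξ) / 2)`
  (`laplaceTransform_besselEntire_path`). So `u(·, 0)` and `f` have the same Laplace transform for
  large `s`, and they agree by Lerch's theorem, proved here by the Weierstrass approximation theorem
  (`eq_zero_of_setIntegral_exp_neg_pow_eq_zero`).
* *The equation.* Green's formula on the quarter plane (`setIntegral_mul_waveAdjoint`) gives the weak
  equation for each kernel, and Fubini's theorem for `u`. If `u` is of class `C²`, Green's formula for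
  `u` itself and the fundamental lemma of the calculus of variations give the equation for `t > 0`;
  evenness and continuity give it for `t ≤ 0`, and evenness also gives `u_t(y, 0) = 0`.
* *Regularity.* Two derivatives of the kernel cost `l²` and improve the decay to `l ^ (-5/4)`, which
  is where the moment `l ^ (3/4)` comes from (`contDiffOn_profileIntegral`).
-/

/-! ### The entire functions behind the Bessel functions -/

section PowerSeries

open scoped Nat

/-- The entire function `z ↦ ∑ (-1)ᵏ / (k! (k+n)!) (z/4)ᵏ`, so that
`Jₙ(x) = (x/2)ⁿ besselEntire n (x²)`. -/
noncomputable def besselEntire (n : ℕ) (z : ℝ) : ℝ :=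
  ∑' k : ℕ, (-1) ^ k / ((k ! : ℝ) * ((k + n)! : ℝ)) * (z / 4) ^ k

lemma norm_besselEntire_term_le (n k : ℕ) (z : ℝ) :
    ‖(-1 : ℝ) ^ k / ((k ! : ℝ) * ((k + n)! : ℝ)) * (z / 4) ^ k‖ ≤ |z / 4| ^ k / (k ! : ℝ) := by
  have h1 : (1 : ℝ) ≤ ((k + n)! : ℝ) := by exact_mod_cast Nat.succ_le_of_lt (Nat.factorial_pos _)
  have h2 : (0 : ℝ) < (k ! : ℝ) := by exact_mod_cast Nat.factorial_pos _
  rw [norm_mul, norm_div, norm_pow, norm_neg, norm_one, one_pow, norm_pow, Real.norm_eq_abs (z / 4),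
    Real.norm_of_nonneg (by positivity), div_mul_eq_mul_div, one_mul]
  apply div_le_div_of_nonneg_left (by positivity) h2
  exact le_mul_of_one_le_right h2.le h1

lemma summable_besselEntire (n : ℕ) (z : ℝ) :
    Summable fun k : ℕ => (-1 : ℝ) ^ k / ((k ! : ℝ) * ((k + n)! : ℝ)) * (z / 4) ^ k :=
  Summable.of_norm_bounded (Real.summable_pow_div_factorial _)
    fun k => norm_besselEntire_term_le n k z

lemma hasDerivAt_besselEntire (n : ℕ) (z : ℝ) :
    HasDerivAt (besselEntire n) (-(besselEntire (n + 1) z) / 4) z := by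
  set R : ℝ := |z| + 1
  have hR : 0 < R := by positivity
  have hu : Summable fun k : ℕ => (k : ℝ) * (R / 4) ^ (k - 1) / (k ! : ℝ) := by
    rw [← summable_nat_add_iff 1]
    refine (Real.summable_pow_div_factorial (R / 4)).congr fun k => ?_
    have : (k ! : ℝ) ≠ 0 := by positivity
    rw [Nat.factorial_succ]; push_cast
    have h3 : (k : ℝ) + 1 ≠ 0 := by positivity
    field_simp
  have key := hasDerivAt_tsum_of_isPreconnected (𝕜 := ℝ)
    (g := fun (k : ℕ) (x : ℝ) => (-1 : ℝ) ^ k / ((k ! : ℝ) * ((k + n)! : ℝ)) * (x / 4) ^ k)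
    (g' := fun (k : ℕ) (x : ℝ) => (-1 : ℝ) ^ k / ((k ! : ℝ) * ((k + n)! : ℝ)) *
      ((k : ℝ) * (x / 4) ^ (k - 1) * (1 / 4)))
    (t := Metric.ball 0 R) (y₀ := 0) (y := z) hu Metric.isOpen_ball
    (convex_ball _ _).isPreconnected ?_ ?_ (Metric.mem_ball_self hR)
    (summable_besselEntire n 0) (by simp [R])
  · refine key.congr_deriv ?_
    have hs : Summable fun k : ℕ => (-1 : ℝ) ^ k / ((k ! : ℝ) * ((k + n)! : ℝ)) *
        ((k : ℝ) * (z / 4) ^ (k - 1) * (1 / 4)) := by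
      rw [← summable_nat_add_iff 1]
      refine ((summable_besselEntire (n + 1) z).mul_left (-1 / 4)).congr fun k => ?_
      have : (k ! : ℝ) ≠ 0 := by positivity
      rw [Nat.factorial_succ k, show k + 1 + n = k + (n + 1) by ring]; push_cast
      have h3 : (k : ℝ) + 1 ≠ 0 := by positivity
      field_simp
      ring
    rw [hs.tsum_eq_zero_add]
    simp only [besselEntire]
    rw [show ∀ x : ℝ, -x / 4 = (-1 / 4) * x from fun x => by ring, ← tsum_mul_left]
    simp only [Nat.cast_zero, zero_mul, mul_zero, zero_add]
    congr 1
    ext k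
    have : (k ! : ℝ) ≠ 0 := by positivity
    rw [Nat.factorial_succ k, show k + 1 + n = k + (n + 1) by ring]; push_cast
    have h3 : (k : ℝ) + 1 ≠ 0 := by positivity
    field_simp
    ring
  · intro k x _
    have := (((hasDerivAt_id x).div_const 4).pow k).const_mul
      ((-1 : ℝ) ^ k / ((k ! : ℝ) * ((k + n)! : ℝ)))
    simpa using this
  · intro k x hx
    have h1 : (1 : ℝ) ≤ ((k + n)! : ℝ) := by
      exact_mod_cast Nat.succ_le_of_lt (Nat.factorial_pos _)
    have h2 : (0 : ℝ) < (k ! : ℝ) := by exact_mod_cast Nat.factorial_pos _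
    have hxR : |x| ≤ R := by simpa using (mem_ball_zero_iff.1 hx).le
    have hx4 : |x / 4| ≤ R / 4 := by rw [abs_div]; norm_num; linarith
    rw [norm_mul, norm_div, norm_pow, norm_neg, norm_one, one_pow, norm_mul ((k : ℝ) * _), norm_mul (k : ℝ),
      norm_pow,
      Real.norm_eq_abs (x / 4), Real.norm_of_nonneg (by positivity : (0:ℝ) ≤ (k ! : ℝ) * ((k + n)! : ℝ)),
      Real.norm_of_nonneg (by positivity : (0 : ℝ) ≤ k),
      Real.norm_of_nonneg (by positivity : (0 : ℝ) ≤ 1 / 4), div_mul_eq_mul_div, one_mul]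
    apply div_le_div₀ (by positivity) _ h2 (le_mul_of_one_le_right h2.le h1)
    calc (k : ℝ) * |x / 4| ^ (k - 1) * (1 / 4) ≤ (k : ℝ) * (R / 4) ^ (k - 1) * 1 := by
          gcongr; norm_num
      _ = _ := mul_one _

lemma contDiff_besselEntire (n : ℕ) {m : ℕ} : ContDiff ℝ m (besselEntire n) := by
  induction m generalizing n with
  | zero =>
    exact contDiff_zero.2 (continuous_iff_continuousAt.2 fun z =>
      (hasDerivAt_besselEntire n z).continuousAt)
  | succ m ih =>
    push_cast
    rw [contDiff_succ_iff_deriv]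
    refine ⟨fun z => (hasDerivAt_besselEntire n z).differentiableAt, by simp, ?_⟩
    rw [funext fun z => (hasDerivAt_besselEntire n z).deriv]
    exact (ih (n + 1)).neg.div_const 4

lemma continuous_besselEntire (n : ℕ) : Continuous (besselEntire n) :=
  (contDiff_besselEntire n (m := 0)).continuous

/-- The three-term recurrence, that is, Bessel's equation `z g'' + g' + g / 4 = 0` for
`g = besselEntire 0`. -/
lemma mul_besselEntire_two (z : ℝ) :
    z * besselEntire 2 z = 4 * (besselEntire 1 z - besselEntire 0 z) := by
  have h : besselEntire 1 z - besselEntire 0 z = z / 4 * besselEntire 2 z := by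
    simp only [besselEntire]
    rw [← (summable_besselEntire 1 z).tsum_sub (summable_besselEntire 0 z), ← tsum_mul_left,
      ((summable_besselEntire 1 z).sub (summable_besselEntire 0 z)).tsum_eq_zero_add]
    simp only [pow_zero, Nat.factorial]
    norm_num
    congr 1
    ext k
    have : (k ! : ℝ) ≠ 0 := by positivity
    have h3 : (k : ℝ) + 1 ≠ 0 := by positivity
    have h4 : (k : ℝ) + 1 + 1 ≠ 0 := by positivity
    field_simp
    ring
  rw [h]; ring

lemma besselJ0_sqrt {z : ℝ} (hz : 0 ≤ z) : besselJ0 (Real.sqrt z) = besselEntire 0 z := by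
  simp only [besselJ0, besselEntire]
  congr 1; ext k
  rw [pow_mul, div_pow, Real.sq_sqrt hz, add_zero]
  norm_num [sq]

lemma two_thirds_le_besselEntire_one : 2 / 3 ≤ besselEntire 0 1 := by
  have hs := summable_besselEntire 0 1
  have h : ‖∑' k : ℕ, (-1 : ℝ) ^ (k + 1) / (((k + 1)! : ℝ) * ((k + 1 + 0)! : ℝ)) *
      (1 / 4) ^ (k + 1)‖ ≤ 1 / 3 := by
    have hg : HasSum (fun k : ℕ => (1 / 4 : ℝ) * (1 / 4) ^ k) (1 / 3) := by
      have := (hasSum_geometric_of_lt_one (r := (1 / 4 : ℝ)) (by norm_num) (by norm_num)).mul_left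
        (1 / 4 : ℝ)
      norm_num at this ⊢
      exact this
    refine tsum_of_norm_bounded hg fun k => (norm_besselEntire_term_le 0 (k + 1) 1).trans ?_
    have h1 : (1 : ℝ) ≤ ((k + 1)! : ℝ) := by
      exact_mod_cast Nat.succ_le_of_lt (Nat.factorial_pos _)
    rw [abs_of_pos (by norm_num : (0 : ℝ) < 1 / 4)]
    refine (div_le_self (by positivity) h1).trans (le_of_eq ?_)
    ring
  have h2 : besselEntire 0 1 = 1 + ∑' k : ℕ, (-1 : ℝ) ^ (k + 1) /
      (((k + 1)! : ℝ) * ((k + 1 + 0)! : ℝ)) * (1 / 4) ^ (k + 1) := by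
    rw [besselEntire, hs.tsum_eq_zero_add]
    simp
  rw [h2]
  have := (abs_le.1 h).1
  linarith

end PowerSeries

/-! ### Decay of the Bessel functions by the energy method -/

/-- The energy `v'² + (1 + 1 / (4 x²)) v²` of `v(x) = √x J₀(x)`, a solution of
`v'' + (1 + 1 / (4 x²)) v = 0`, as a function of `z = x²`. -/
noncomputable def besselEnergy (z : ℝ) : ℝ :=
  (besselEntire 0 z ^ 2 / 4 + z * besselEntire 0 z ^ 2 +
    (besselEntire 0 z / 2 - z * besselEntire 1 z / 2) ^ 2) / √z

lemma hasDerivAt_besselEnergy {z : ℝ} (hz : 0 < z) :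
    HasDerivAt besselEnergy (-(besselEntire 0 z ^ 2) / (4 * z * √z)) z := by
  have h0 := hasDerivAt_besselEntire 0 z
  have h1 := hasDerivAt_besselEntire 1 z
  have hr := mul_besselEntire_two z
  have hs : √z ≠ 0 := (Real.sqrt_pos.2 hz).ne'
  have hs2 : √z ^ 2 = z := Real.sq_sqrt hz.le
  have := ((((h0.pow 2).div_const 4).add ((hasDerivAt_id z).mul (h0.pow 2))).add
    (((h0.div_const 2).sub (((hasDerivAt_id z).mul h1).div_const 2)).pow 2)).div
    (Real.hasDerivAt_sqrt hz.ne') hs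
  refine this.congr_deriv ?_
  simp only [Pi.add_apply, Pi.mul_apply, Pi.pow_apply, id, Pi.sub_apply, zero_add,
    one_add_one_eq_two] at hr ⊢
  generalize besselEntire 0 z = a at *
  generalize besselEntire 1 z = b at *
  generalize besselEntire 2 z = c at *
  generalize √z = r at *
  subst hs2
  field_simp
  push_cast
  linear_combination 16 * (r ^ 2 * a - r ^ 4 * b) * hr

lemma differentiableOn_besselEnergy : DifferentiableOn ℝ besselEnergy (Ici 1) := fun _ hz =>
  (hasDerivAt_besselEnergy (zero_lt_one.trans_le hz)).differentiableAt.differentiableWithinAt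

lemma besselEnergy_one_pos : 0 < besselEnergy 1 := by
  have h := two_thirds_le_besselEntire_one
  rw [besselEnergy, Real.sqrt_one, div_one]
  have : 0 < besselEntire 0 1 := by linarith
  positivity

lemma besselEnergy_le {z : ℝ} (hz : 1 ≤ z) : besselEnergy z ≤ besselEnergy 1 := by
  have : AntitoneOn besselEnergy (Ici 1) := by
    refine antitoneOn_of_deriv_nonpos (convex_Ici 1) differentiableOn_besselEnergy.continuousOn
      (differentiableOn_besselEnergy.mono interior_subset) fun x hx => ?_
    rw [interior_Ici, mem_Ioi] at hx
    have hx0 : 0 < x := by linarith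
    rw [(hasDerivAt_besselEnergy hx0).deriv, neg_div]
    exact neg_nonpos.2 (by positivity)
  exact this (mem_Ici.2 le_rfl) hz hz

lemma sqrt_mul_sq_le_besselEnergy {z : ℝ} (hz : 0 < z) :
    √z * besselEntire 0 z ^ 2 ≤ besselEnergy z := by
  have hs : 0 < √z := Real.sqrt_pos.2 hz
  rw [besselEnergy, le_div_iff₀ hs, mul_right_comm, Real.mul_self_sqrt hz.le]
  nlinarith [sq_nonneg (besselEntire 0 z),
    sq_nonneg (besselEntire 0 z / 2 - z * besselEntire 1 z / 2)]

/-- The energy cannot decay to zero: `(1 - 1 / (4 z)) besselEnergy z` is nondecreasing. -/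
lemma le_besselEnergy {z : ℝ} (hz : 1 ≤ z) : 3 / 4 * besselEnergy 1 ≤ besselEnergy z := by
  have hd : ∀ x : ℝ, 1 ≤ x → HasDerivAt (fun x => (1 - 1 / 4 * x⁻¹) * besselEnergy x)
      ((1 / 4 / x ^ 2) * besselEnergy x +
        (1 - 1 / 4 * x⁻¹) * (-(besselEntire 0 x ^ 2) / (4 * x * √x))) x := by
    intro x hx
    have hx0 : 0 < x := by linarith
    have := (((hasDerivAt_inv hx0.ne').const_mul (1 / 4 : ℝ)).const_sub 1).mul
      (hasDerivAt_besselEnergy hx0)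
    refine this.congr_deriv ?_
    ring
  have hdiff : DifferentiableOn ℝ (fun x => (1 - 1 / 4 * x⁻¹) * besselEnergy x) (Ici 1) :=
    fun x hx => (hd x hx).differentiableAt.differentiableWithinAt
  have hmono : MonotoneOn (fun x => (1 - 1 / 4 * x⁻¹) * besselEnergy x) (Ici 1) := by
    refine monotoneOn_of_deriv_nonneg (convex_Ici 1) hdiff.continuousOn
      (hdiff.mono interior_subset) fun x hx => ?_
    rw [interior_Ici, mem_Ioi] at hx
    have hx0 : 0 < x := by linarith
    have hs : 0 < √x := Real.sqrt_pos.2 hx0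
    have hE := sqrt_mul_sq_le_besselEnergy hx0
    rw [(hd x hx.le).deriv]
    have h1 : besselEntire 0 x ^ 2 / (4 * x * √x) ≤ 1 / 4 / x ^ 2 * besselEnergy x := by
      calc besselEntire 0 x ^ 2 / (4 * x * √x)
          = 1 / 4 / x ^ 2 * (√x * besselEntire 0 x ^ 2) := by
            have h2 : x = √x ^ 2 := (Real.sq_sqrt hx0.le).symm
            generalize √x = r at *
            subst h2
            field_simp
        _ ≤ _ := by gcongr
    have h2 : (1 - 1 / 4 * x⁻¹) * (besselEntire 0 x ^ 2 / (4 * x * √x)) ≤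
        1 * (besselEntire 0 x ^ 2 / (4 * x * √x)) := by
      apply mul_le_mul_of_nonneg_right _ (by positivity)
      have : 0 ≤ x⁻¹ := by positivity
      linarith
    rw [neg_div, mul_neg]
    linarith
  have h := hmono (mem_Ici.2 le_rfl) hz hz
  simp only [inv_one, mul_one] at h
  have hz0 : 0 < z := by linarith
  have hE : 0 ≤ besselEnergy z := le_trans (by positivity) (sqrt_mul_sq_le_besselEnergy hz0)
  have : (1 - 1 / 4 * z⁻¹) * besselEnergy z ≤ 1 * besselEnergy z := by
    apply mul_le_mul_of_nonneg_right _ hE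
    have : 0 ≤ z⁻¹ := by positivity
    linarith
  linarith

lemma abs_le_mul_one_add_rpow {h : ℝ → ℝ} (hc : Continuous h) {α K : ℝ} (hα : 0 < α)
    (hK : ∀ z, 1 ≤ z → |h z| * z ^ α ≤ K) :
    ∃ C > 0, ∀ z, 0 ≤ z → |h z| ≤ C * (1 + z) ^ (-α) := by
  obtain ⟨M, hM⟩ := (isCompact_Icc (a := (0 : ℝ)) (b := 1)).exists_bound_of_continuousOn
    hc.continuousOn
  have hM0 : 0 ≤ M := (norm_nonneg _).trans (hM 0 (by simp))
  have hK0 : 0 ≤ K := le_trans (by positivity) (hK 1 le_rfl)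
  refine ⟨2 ^ α * (K + M) + 1, by positivity, fun z hz => ?_⟩
  have hz1 : 0 < 1 + z := by linarith
  rw [Real.rpow_neg hz1.le, ← div_eq_mul_inv, le_div_iff₀ (by positivity)]
  rcases le_total z 1 with h1 | h1
  · have h2 : (1 + z) ^ α ≤ 2 ^ α := Real.rpow_le_rpow hz1.le (by linarith) hα.le
    have h3 : |h z| ≤ M := hM z ⟨hz, h1⟩
    calc |h z| * (1 + z) ^ α ≤ M * 2 ^ α := by gcongr
      _ ≤ _ := by nlinarith [(by positivity : (0 : ℝ) ≤ 2 ^ α * K)]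
  · have h2 : (1 + z) ^ α ≤ 2 ^ α * z ^ α := by
      rw [← Real.mul_rpow (by norm_num) hz]
      exact Real.rpow_le_rpow hz1.le (by linarith) hα.le
    calc |h z| * (1 + z) ^ α ≤ |h z| * (2 ^ α * z ^ α) := by gcongr
      _ = 2 ^ α * (|h z| * z ^ α) := by ring
      _ ≤ 2 ^ α * K := by gcongr; exact hK z h1
      _ ≤ _ := by nlinarith [(by positivity : (0 : ℝ) ≤ 2 ^ α * M)]

/-- For `z ≥ 1` and `r = z ^ (1/4)`, the energy bound in polynomial form. -/
lemma besselEntire_bounds_of_one_le {r : ℝ} (hr : 1 ≤ r) :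
    |besselEntire 0 (r ^ 4)| * r ≤ √(besselEnergy 1) ∧
    |besselEntire 1 (r ^ 4)| * r ^ 3 ≤ 3 * √(besselEnergy 1) ∧
    |besselEntire 2 (r ^ 4)| * r ^ 5 ≤ 16 * √(besselEnergy 1) := by
  have hr0 : 0 < r := by linarith
  have hz : (1 : ℝ) ≤ r ^ 4 := one_le_pow₀ hr
  have hE := besselEnergy_le hz
  have hs : √(r ^ 4) = r ^ 2 := by
    rw [show r ^ 4 = (r ^ 2) ^ 2 by ring]; exact Real.sqrt_sq (by positivity)
  have hrec := mul_besselEntire_two (r ^ 4)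
  set K := √(besselEnergy 1)
  have hK : K ^ 2 = besselEnergy 1 := Real.sq_sqrt besselEnergy_one_pos.le
  have hK0 : 0 ≤ K := Real.sqrt_nonneg _
  rw [besselEnergy, hs, div_le_iff₀ (by positivity), ← hK] at hE
  generalize besselEntire 0 (r ^ 4) = a at *
  generalize besselEntire 1 (r ^ 4) = b at *
  generalize besselEntire 2 (r ^ 4) = c at *
  have h0 : |a| * r ≤ K := by
    apply abs_le_of_sq_le_sq' _ hK0 |>.2
    have : (|a| * r) ^ 2 * r ^ 2 ≤ K ^ 2 * r ^ 2 := by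
      rw [mul_pow, sq_abs]
      nlinarith [sq_nonneg a, sq_nonneg (a / 2 - r ^ 4 * b / 2)]
    exact le_of_mul_le_mul_right this (by positivity)
  have h1' : |a / 2 - r ^ 4 * b / 2| ≤ K * r := by
    apply abs_le_of_sq_le_sq _ (by positivity)
    nlinarith [sq_nonneg a, mul_nonneg (by positivity : 0 ≤ r ^ 4) (sq_nonneg a)]
  have ha : |a| ≤ K := le_trans (le_mul_of_one_le_right (abs_nonneg a) hr) h0
  have hKr : K ≤ K * r := le_mul_of_one_le_right hK0 hr
  have h1 : |b| * r ^ 3 ≤ 3 * K := by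
    have h2 : |r ^ 4 * b| ≤ |a| + 2 * (K * r) := by
      have : r ^ 4 * b = a - 2 * (a / 2 - r ^ 4 * b / 2) := by ring
      rw [this]
      refine (abs_sub _ _).trans ?_
      rw [abs_mul, abs_two]
      linarith
    rw [abs_mul, abs_of_pos (by positivity : 0 < r ^ 4)] at h2
    refine le_of_mul_le_mul_right ?_ hr0
    calc |b| * r ^ 3 * r = r ^ 4 * |b| := by ring
      _ ≤ 3 * K * r := by linarith
  refine ⟨h0, h1, ?_⟩
  have hb : |b| * r ≤ 3 * K := by
    refine le_trans ?_ h1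
    gcongr
    exact le_self_pow₀ hr (by norm_num)
  have h2 : r ^ 4 * |c| ≤ 4 * (|b| + |a|) := by
    rw [← abs_of_pos (by positivity : 0 < r ^ 4), ← abs_mul, hrec, abs_mul]
    norm_num
    exact abs_sub _ _
  calc |c| * r ^ 5 = r ^ 4 * |c| * r := by ring
    _ ≤ 4 * (|b| + |a|) * r := by gcongr
    _ ≤ _ := by linarith

lemma rpow_quarter_pow {z : ℝ} (hz : 1 ≤ z) : 1 ≤ z ^ (1 / 4 : ℝ) ∧ (z ^ (1 / 4 : ℝ)) ^ 4 = z ∧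
    (z ^ (1 / 4 : ℝ)) ^ 3 = z ^ (3 / 4 : ℝ) ∧ (z ^ (1 / 4 : ℝ)) ^ 5 = z ^ (5 / 4 : ℝ) := by
  have hz0 : 0 ≤ z := by linarith
  refine ⟨Real.one_le_rpow hz (by norm_num), ?_, ?_, ?_⟩ <;>
    · rw [← Real.rpow_natCast, ← Real.rpow_mul hz0]
      norm_num

lemma exists_besselEntire_zero_bound :
    ∃ C > 0, ∀ z, 0 ≤ z → |besselEntire 0 z| ≤ C * (1 + z) ^ (-(1 / 4) : ℝ) :=
  abs_le_mul_one_add_rpow (continuous_besselEntire 0) (by norm_num) fun z hz => by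
    obtain ⟨h1, h4, -, -⟩ := rpow_quarter_pow hz
    have := (besselEntire_bounds_of_one_le h1).1
    rwa [h4] at this

lemma exists_besselEntire_one_bound :
    ∃ C > 0, ∀ z, 0 ≤ z → |besselEntire 1 z| ≤ C * (1 + z) ^ (-(3 / 4) : ℝ) :=
  abs_le_mul_one_add_rpow (continuous_besselEntire 1) (by norm_num) fun z hz => by
    obtain ⟨h1, h4, h3, -⟩ := rpow_quarter_pow hz
    have := (besselEntire_bounds_of_one_le h1).2.1
    rwa [h4, h3] at this

lemma exists_besselEntire_two_bound :
    ∃ C > 0, ∀ z, 0 ≤ z → |besselEntire 2 z| ≤ C * (1 + z) ^ (-(5 / 4) : ℝ) :=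
  abs_le_mul_one_add_rpow (continuous_besselEntire 2) (by norm_num) fun z hz => by
    obtain ⟨h1, h4, -, h5⟩ := rpow_quarter_pow hz
    have := (besselEntire_bounds_of_one_le h1).2.2
    rwa [h4, h5] at this

/-! ### Absolute convergence forces integrability with a weight -/

lemma abs_sub_mul_le_besselEnergy {z : ℝ} (hz : 0 < z) :
    |besselEntire 0 z ^ 2 / 2 - z * besselEntire 0 z * besselEntire 1 z / 2| ≤
      besselEnergy z / 2 := by
  have hs : 0 < √z := Real.sqrt_pos.2 hz
  have hs2 : √z ^ 2 = z := Real.sq_sqrt hz.le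
  rw [besselEnergy, div_div, le_div_iff₀ (by positivity)]
  generalize besselEntire 0 z = a at *
  generalize besselEntire 1 z = b at *
  rw [show a ^ 2 / 2 - z * a * b / 2 = a * (a / 2 - z * b / 2) by ring]
  generalize a / 2 - z * b / 2 = q
  generalize √z = r at *
  subst hs2
  rw [abs_mul]
  nlinarith [sq_nonneg (r * |a| - |q|), sq_abs a, sq_abs q, sq_nonneg a]

/-- Equipartition of the energy: in the phase variable `x = √z`, half of the energy of
`v = √x J₀(x)` sits in `v²` on average, since `v'² - (1 + 1 / (4 x²)) v²` is the derivative of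
`v v'`. -/
lemma hasDerivAt_equipartition {z : ℝ} (hz : 0 < z) :
    HasDerivAt (fun z => besselEntire 0 z ^ 2 / 2 - z * besselEntire 0 z * besselEntire 1 z / 2)
      (besselEnergy z / (2 * √z) - (1 + 1 / (4 * z)) * besselEntire 0 z ^ 2) z := by
  have h0 := hasDerivAt_besselEntire 0 z
  have h1 := hasDerivAt_besselEntire 1 z
  have hr := mul_besselEntire_two z
  have hs : √z ≠ 0 := (Real.sqrt_pos.2 hz).ne'
  have hs2 : √z ^ 2 = z := Real.sq_sqrt hz.le
  have := ((h0.pow 2).div_const 2).sub ((((hasDerivAt_id z).mul h0).mul h1).div_const 2)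
  refine this.congr_deriv ?_
  simp only [Pi.mul_apply, id, zero_add, one_add_one_eq_two, besselEnergy] at hr ⊢
  generalize besselEntire 0 z = a at *
  generalize besselEntire 1 z = b at *
  generalize besselEntire 2 z = c at *
  generalize √z = r at *
  subst hs2
  field_simp
  push_cast
  linear_combination 4 * a * r ^ 2 * hr

lemma continuous_besselEntire_path (l : ℝ) :
    Continuous fun y : ℝ => besselEntire 0 (y ^ 2 + 2 * l * y) :=
  (continuous_besselEntire 0).comp (by fun_prop)

/-- The mean square of `J₀(√(y² + 2 l y))` over `1 ≤ y ≤ 2` has the order of its upper bound: the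
boundary terms of the equipartition of energy are negligible once `l` is at least an absolute
constant, for which `64` suffices. -/
lemma le_integral_besselEntire_sq {l : ℝ} (hl : 64 ≤ l) :
    besselEnergy 1 / 60 / √l ≤ ∫ y in (1 : ℝ)..2, besselEntire 0 (y ^ 2 + 2 * l * y) ^ 2 := by
  set E := besselEnergy 1
  have hE : 0 < E := besselEnergy_one_pos
  set z : ℝ → ℝ := fun y => y ^ 2 + 2 * l * y with hzdef
  set R : ℝ → ℝ := fun z => besselEntire 0 z ^ 2 / 2 - z * besselEntire 0 z * besselEntire 1 z / 2
  have hsl : 8 ≤ √l := Real.le_sqrt_of_sq_le (by linarith)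
  have hsl2 : √l * √l = l := Real.mul_self_sqrt (by linarith)
  have hz1 : ∀ y ∈ Icc (1 : ℝ) 2, 1 ≤ z y := fun y hy => by
    simp only [hzdef]; nlinarith [hy.1, hy.2]
  have hz2 : ∀ y ∈ Icc (1 : ℝ) 2, z y ≤ (3 * √l) ^ 2 := fun y hy => by
    simp only [hzdef]; nlinarith [hy.1, hy.2]
  have hzd : ∀ y, HasDerivAt z (2 * (y + l)) y := fun y => by
    have := ((hasDerivAt_id y).pow 2).add ((hasDerivAt_id y).const_mul (2 * l))
    refine this.congr_deriv ?_
    simp; ring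
  have hR : ∀ y ∈ Icc (1 : ℝ) 2, HasDerivAt (fun y => R (z y))
      ((besselEnergy (z y) / (2 * √(z y)) - (1 + 1 / (4 * z y)) * besselEntire 0 (z y) ^ 2) *
        (2 * (y + l))) y := fun y hy =>
    (hasDerivAt_equipartition (zero_lt_one.trans_le (hz1 y hy))).comp y (hzd y)
  have hG : Continuous fun y => besselEntire 0 (z y) := continuous_besselEntire_path l
  have hcR : Continuous R :=
    (((continuous_besselEntire 0).pow 2).div_const 2).sub
      (((continuous_id.mul (continuous_besselEntire 0)).mul (continuous_besselEntire 1)).div_const 2)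
  have hcz : Continuous z := by fun_prop
  -- Equipartition bounds the derivative of the primitive of `g²` below by that of
  -- `y ↦ E √l / 8 * y - R (z y) / 2`, and the increment of `R` is at most `E`.
  have hmono : MonotoneOn (fun y => (15 / 4 * l) *
      (∫ x in (1 : ℝ)..y, besselEntire 0 (z x) ^ 2) - (E * √l / 8) * y + R (z y) / 2)
      (Icc 1 2) := by
    have hcts : ContinuousOn (fun y => ∫ x in (1 : ℝ)..y, besselEntire 0 (z x) ^ 2) (Icc 1 2) :=
      (intervalIntegral.continuous_primitive
        (fun a b => (hG.pow 2).intervalIntegrable a b) 1).continuousOn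
    have hd : ∀ y ∈ Ioo (1 : ℝ) 2, HasDerivAt (fun y => (15 / 4 * l) *
      (∫ x in (1 : ℝ)..y, besselEntire 0 (z x) ^ 2) - (E * √l / 8) * y + R (z y) / 2)
      ((15 / 4 * l) * besselEntire 0 (z y) ^ 2 - (E * √l / 8) * 1 +
      ((besselEnergy (z y) / (2 * √(z y)) - (1 + 1 / (4 * z y)) * besselEntire 0 (z y) ^ 2) *
        (2 * (y + l))) / 2) y := fun y hy =>
      ((((hG.pow 2).integral_hasStrictDerivAt 1 y).hasDerivAt.const_mul _).sub
        ((hasDerivAt_id y).const_mul _)).add ((hR y (Ioo_subset_Icc_self hy)).div_const 2)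
    refine monotoneOn_of_deriv_nonneg (convex_Icc 1 2) ?_ ?_ ?_
    · exact ((continuousOn_const.mul hcts).sub (by fun_prop)).add
        ((hcR.comp hcz).div_const 2).continuousOn
    · rw [interior_Icc]
      exact fun y hy => (hd y hy).differentiableAt.differentiableWithinAt
    · rw [interior_Icc]
      intro y hy
      rw [(hd y hy).deriv]
      have hy' := Ioo_subset_Icc_self hy
      have h1 := hz1 y hy'
      have h2 : √(z y) ≤ 3 * √l := by
        rw [Real.sqrt_le_left (by positivity)]; exact hz2 y hy'
      have h3 : 0 < √(z y) := Real.sqrt_pos.2 (by linarith)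
      have h4 := le_besselEnergy h1
      have h5 : E * √l / 8 ≤ besselEnergy (z y) / (2 * √(z y)) * (y + l) := by
        rw [div_mul_eq_mul_div, le_div_iff₀ (by positivity)]
        calc E * √l / 8 * (2 * √(z y)) ≤ E * √l / 8 * (2 * (3 * √l)) := by gcongr
          _ = 3 / 4 * E * l := by linear_combination 3 / 4 * E * hsl2
          _ ≤ besselEnergy (z y) * (y + l) := by
            apply mul_le_mul h4 (by linarith [hy.1]) (by linarith) (le_trans (by positivity) h4)
      have h6 : (1 + 1 / (4 * z y)) * (y + l) ≤ 15 / 4 * l := by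
        have : 1 / (4 * z y) ≤ 1 / 4 := by
          apply one_div_le_one_div_of_le <;> linarith
        calc (1 + 1 / (4 * z y)) * (y + l) ≤ (1 + 1 / 4) * (3 * l) := by
              apply mul_le_mul <;> linarith [hy.1, hy.2]
          _ = _ := by ring
      have h7 := mul_le_mul_of_nonneg_right h6 (sq_nonneg (besselEntire 0 (z y)))
      nlinarith
  have h := hmono (left_mem_Icc.2 one_le_two) (right_mem_Icc.2 one_le_two) one_le_two
  simp only [intervalIntegral.integral_same] at h
  have hb : ∀ y ∈ Icc (1 : ℝ) 2, |R (z y)| ≤ E / 2 := fun y hy =>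
    (abs_sub_mul_le_besselEnergy (zero_lt_one.trans_le (hz1 y hy))).trans
      (by linarith [besselEnergy_le (hz1 y hy)])
  have hb1 := abs_le.1 (hb 1 (left_mem_Icc.2 one_le_two))
  have hb2 := abs_le.1 (hb 2 (right_mem_Icc.2 one_le_two))
  have h8 : E * √l / 16 ≤ (15 / 4 * l) * ∫ x in (1 : ℝ)..2, besselEntire 0 (z x) ^ 2 := by
    nlinarith
  rw [div_le_iff₀ (by positivity)]
  change _ ≤ (∫ x in (1 : ℝ)..2, besselEntire 0 (z x) ^ 2) * √l
  generalize ∫ x in (1 : ℝ)..2, besselEntire 0 (z x) ^ 2 = I at *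
  have h9 : √l * (E / 60) ≤ √l * (I * √l) := by
    have : √l * (I * √l) = l * I := by linear_combination I * hsl2
    rw [this]; linarith
  exact le_of_mul_le_mul_left h9 (by linarith)

lemma abs_besselEntire_path_le {l y : ℝ} (hl : 1 ≤ l) (hy : 1 ≤ y) :
    |besselEntire 0 (y ^ 2 + 2 * l * y)| ≤ √(besselEnergy 1) * l ^ (-(1 / 4) : ℝ) := by
  have hz : l ≤ y ^ 2 + 2 * l * y := by nlinarith
  have hz1 : 1 ≤ y ^ 2 + 2 * l * y := hl.trans hz
  obtain ⟨h1, h4, -⟩ := rpow_quarter_pow hz1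
  have h := (besselEntire_bounds_of_one_le h1).1
  rw [h4] at h
  rw [Real.rpow_neg (by linarith), ← div_eq_mul_inv, le_div_iff₀ (by positivity)]
  refine le_trans ?_ h
  gcongr

/-- If `A` fills almost all of `[1, 2]`, the mean of `|J₀(√(y² + 2 l y))|` over `y ∈ A` is at least
a multiple of `l ^ (-1/4)`. -/
lemma le_setIntegral_abs_besselEntire {A : Set ℝ} (hA : MeasurableSet A) (hA' : A ⊆ Ioc 1 2)
    (hvol : volume.real (Ioc 1 2 \ A) ≤ 1 / 120) {l : ℝ} (hl : 64 ≤ l) :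
    √(besselEnergy 1) / 120 * l ^ (-(1 / 4) : ℝ) ≤
      ∫ y in A, |besselEntire 0 (y ^ 2 + 2 * l * y)| := by
  have hE : 0 < besselEnergy 1 := besselEnergy_one_pos
  set K := √(besselEnergy 1)
  have hK : 0 < K := Real.sqrt_pos.2 hE
  have hK2 : K ^ 2 = besselEnergy 1 := Real.sq_sqrt hE.le
  set m := l ^ (-(1 / 4) : ℝ) with hm
  have hl0 : 0 < l := by linarith
  have hm0 : 0 < m := by positivity
  have hm2 : 1 / √l = m ^ 2 := by
    rw [hm, ← Real.rpow_natCast, ← Real.rpow_mul hl0.le, Real.sqrt_eq_rpow, one_div,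
      ← Real.rpow_neg hl0.le]
    norm_num
  set g : ℝ → ℝ := fun y => besselEntire 0 (y ^ 2 + 2 * l * y)
  have hg : Continuous g := continuous_besselEntire_path l
  have hint : ∀ {B : Set ℝ} {h : ℝ → ℝ}, B ⊆ Ioc 1 2 → Continuous h → IntegrableOn h B :=
    fun hB hh => ((hh.integrableOn_Icc (a := 1) (b := 2)).mono_set
      (hB.trans Ioc_subset_Icc_self))
  have hg2 : Continuous fun y => g y ^ 2 := hg.pow 2
  have h1 : besselEnergy 1 / 60 / √l ≤ ∫ y in (1 : ℝ)..2, g y ^ 2 := le_integral_besselEntire_sq hl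
  rw [intervalIntegral.integral_of_le one_le_two, ← sdiff_union_of_subset hA',
    setIntegral_union disjoint_sdiff_left hA (hint sdiff_subset hg2) (hint hA' hg2)] at h1
  have hb : ∀ y ∈ Ioc (1 : ℝ) 2, |g y| ≤ K * m := fun y hy =>
    abs_besselEntire_path_le (by linarith) hy.1.le
  have hfin : volume (Ioc (1 : ℝ) 2 \ A) < ⊤ :=
    (measure_mono sdiff_subset).trans_lt measure_Ioc_lt_top
  -- The part of `[1, 2]` outside `A` carries at most half of the lower bound in `h1`.
  have h2 : ∫ y in Ioc 1 2 \ A, g y ^ 2 ≤ 1 / 120 * (K * m) ^ 2 := by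
    have := norm_setIntegral_le_of_norm_le_const (μ := volume) (f := fun y => g y ^ 2)
      (C := (K * m) ^ 2) hfin (fun y hy => by
        rw [norm_pow, Real.norm_eq_abs]
        exact pow_le_pow_left₀ (abs_nonneg _) (hb y hy.1) 2)
    refine (le_abs_self _).trans (this.trans ?_)
    rw [mul_comm]
    gcongr
  -- The upper bound for `|g|` turns the mean square into a mean of `|g|`.
  have h3 : ∫ y in A, g y ^ 2 ≤ (K * m) * ∫ y in A, |g y| := by
    rw [← integral_const_mul]
    refine setIntegral_mono_on (hint hA' hg2) (hint hA' (hg.abs.const_mul _)) hA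
      fun y hy => ?_
    rw [← sq_abs, sq]
    exact mul_le_mul_of_nonneg_right (hb y (hA' hy)) (abs_nonneg _)
  have h4 : besselEnergy 1 / 60 / √l = 1 / 60 * (K * m) ^ 2 := by
    rw [mul_pow, ← hm2, hK2]; ring
  have h5 : (K * m) * (K / 120 * m) ≤ (K * m) * ∫ y in A, |g y| := by nlinarith
  exact le_of_mul_le_mul_left h5 (by positivity)

lemma exists_large_subset_bounded {F : ℝ → ENNReal} (hF : Measurable F)
    (hfin : ∀ y ∈ Ioc (1 : ℝ) 2, F y < ⊤) {ε : ℝ} (hε : 0 < ε) :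
    ∃ A ⊆ Ioc (1 : ℝ) 2, MeasurableSet A ∧ volume.real (Ioc (1 : ℝ) 2 \ A) ≤ ε ∧
      ∃ M : ℕ, ∀ y ∈ A, F y ≤ M := by
  have hm : ∀ n : ℕ, MeasurableSet (Ioc (1 : ℝ) 2 ∩ {y | (n : ENNReal) < F y}) := fun n =>
    measurableSet_Ioc.inter (measurableSet_lt measurable_const hF)
  have ht := tendsto_measure_iInter_atTop (μ := volume)
    (s := fun n : ℕ => Ioc (1 : ℝ) 2 ∩ {y | (n : ENNReal) < F y})
    (fun n => (hm n).nullMeasurableSet)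
    (fun n k hnk y hy => ⟨hy.1, (Nat.cast_le.2 hnk : (n : ENNReal) ≤ k).trans_lt hy.2⟩)
    ⟨0, ((measure_mono inter_subset_left).trans_lt measure_Ioc_lt_top).ne⟩
  have he : ⋂ n : ℕ, Ioc (1 : ℝ) 2 ∩ {y | (n : ENNReal) < F y} = ∅ := by
    refine eq_empty_of_forall_notMem fun y hy => ?_
    rw [mem_iInter] at hy
    obtain ⟨n, hn⟩ := ENNReal.exists_nat_gt (hfin y (hy 0).1).ne
    exact (hy n).2.not_gt hn
  rw [he, measure_empty] at ht
  obtain ⟨n, hn⟩ := (ht.eventually (gt_mem_nhds (ENNReal.ofReal_pos.2 hε))).exists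
  refine ⟨Ioc 1 2 \ (Ioc 1 2 ∩ {y | (n : ENNReal) < F y}), sdiff_subset,
    measurableSet_Ioc.diff (hm n), ?_, n, fun y hy => ?_⟩
  · rw [sdiff_sdiff_cancel_left inter_subset_left, measureReal_def]
    exact ENNReal.toReal_le_of_le_ofReal hε.le hn.le
  · by_contra h
    exact hy.2 ⟨hy.1, not_le.1 h⟩

/-- Absolute convergence of the integral `∫ φ(l) J₀(√(y² + 2 l y)) dl` for every `y`, however the
zeros of `J₀` are placed, already forces `(1 + l) ^ (-1/4) φ` to be integrable: average over `y`. -/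
lemma integrableOn_rpow_mul_of_integrableOn_bessel {φ : ℝ → ℝ}
    (hφ : AEStronglyMeasurable φ (volume.restrict (Ioi 0)))
    (hloc : IntegrableOn φ (Ioc 0 64))
    (h : ∀ y > 0, IntegrableOn (fun l => φ l * besselEntire 0 (y ^ 2 + 2 * l * y)) (Ioi 0)) :
    IntegrableOn (fun l => (1 + l) ^ (-(1 / 4) : ℝ) * φ l) (Ioi 0) := by
  set μ : Measure ℝ := volume.restrict (Ioi 0)
  set ψ := hφ.mk φ
  have hψm : StronglyMeasurable ψ := hφ.stronglyMeasurable_mk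
  have hψ : φ =ᵐ[μ] ψ := hφ.ae_eq_mk
  have hker : Continuous fun p : ℝ × ℝ => besselEntire 0 (p.1 ^ 2 + 2 * p.2 * p.1) :=
    (continuous_besselEntire 0).comp (by fun_prop)
  set G : ℝ × ℝ → ENNReal := fun p => ‖ψ p.2 * besselEntire 0 (p.1 ^ 2 + 2 * p.2 * p.1)‖ₑ
  have hG : Measurable G :=
    ((hψm.measurable.comp measurable_snd).mul hker.measurable).enorm
  have hfin : ∀ y ∈ Ioc (1 : ℝ) 2, ∫⁻ l, G (y, l) ∂μ < ⊤ := fun y hy => by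
    have h1 : Integrable (fun l => ψ l * besselEntire 0 (y ^ 2 + 2 * l * y)) μ :=
      (h y (by linarith [hy.1])).congr (hψ.mono fun l hl => by simp [hl])
    exact h1.2
  obtain ⟨A, hA, hAm, hvol, M, hM⟩ := exists_large_subset_bounded hG.lintegral_prod_right' hfin
    (ε := 1 / 120) (by norm_num)
  set c := √(besselEnergy 1) / 120
  have hc : 0 < c := div_pos (Real.sqrt_pos.2 besselEnergy_one_pos) (by norm_num)
  have hAfin : volume A < ⊤ := (measure_mono hA).trans_lt measure_Ioc_lt_top
  have hI1 : ∫⁻ y in A, ∫⁻ l, G (y, l) ∂μ < ⊤ := by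
    calc ∫⁻ y in A, ∫⁻ l, G (y, l) ∂μ ≤ ∫⁻ _ in A, (M : ENNReal) :=
          setLIntegral_mono measurable_const hM
      _ = M * volume A := setLIntegral_const _ _
      _ < ⊤ := ENNReal.mul_lt_top (by simp) hAfin
  rw [lintegral_lintegral_swap hG.aemeasurable] at hI1
  have hlow : ∀ l ∈ Ioi (64 : ℝ), ENNReal.ofReal c * ‖(1 + l) ^ (-(1 / 4) : ℝ) * ψ l‖ₑ ≤
      ∫⁻ y in A, G (y, l) := by
    intro l hl
    have hl' : (64 : ℝ) ≤ l := le_of_lt hl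
    have h1 := le_setIntegral_abs_besselEntire hAm hA hvol hl'
    have hint : Integrable (fun y => besselEntire 0 (y ^ 2 + 2 * l * y)) (volume.restrict A) :=
      ((continuous_besselEntire_path l).integrableOn_Icc (a := 1) (b := 2)).mono_set
        (hA.trans Ioc_subset_Icc_self)
    have h2 : ∫⁻ y in A, G (y, l) =
        ‖ψ l‖ₑ * ENNReal.ofReal (∫ y in A, |besselEntire 0 (y ^ 2 + 2 * l * y)|) := by
      have h3 : ENNReal.ofReal (∫ y in A, |besselEntire 0 (y ^ 2 + 2 * l * y)|) =
          ∫⁻ y in A, ‖besselEntire 0 (y ^ 2 + 2 * l * y)‖ₑ :=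
        ofReal_integral_norm_eq_lintegral_enorm hint
      rw [h3, ← lintegral_const_mul]
      · simp only [G, enorm_mul]
      · exact (continuous_besselEntire_path l).measurable.enorm
    have h4 : (1 + l) ^ (-(1 / 4) : ℝ) ≤ l ^ (-(1 / 4) : ℝ) :=
      Real.rpow_le_rpow_of_nonpos (by linarith) (by linarith) (by norm_num)
    rw [h2, enorm_mul, ← mul_assoc, mul_comm]
    gcongr
    have h5 : 0 ≤ (1 + l) ^ (-(1 / 4) : ℝ) := Real.rpow_nonneg (by linarith) _
    rw [Real.enorm_of_nonneg h5, ← ENNReal.ofReal_mul hc.le]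
    refine ENNReal.ofReal_le_ofReal (le_trans ?_ h1)
    gcongr
  have hfar : IntegrableOn (fun l => (1 + l) ^ (-(1 / 4) : ℝ) * ψ l) (Ioi 64) := by
    refine ⟨?_, ?_⟩
    · exact (Measurable.mul (by fun_prop) hψm.measurable).aestronglyMeasurable
    · have h1 : ENNReal.ofReal c *
          ∫⁻ l in Ioi 64, ‖(1 + l) ^ (-(1 / 4) : ℝ) * ψ l‖ₑ < ⊤ := by
        rw [← lintegral_const_mul' _ _ ENNReal.ofReal_ne_top]
        refine (setLIntegral_mono' measurableSet_Ioi hlow).trans_lt ?_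
        refine (lintegral_mono_set ?_).trans_lt hI1
        exact Ioi_subset_Ioi (by norm_num)
      exact (ENNReal.mul_lt_top_iff.1 h1).elim (fun h => h.2) (fun h => h.elim
        (fun h => absurd h (ENNReal.ofReal_pos.2 hc).ne') (fun h => h.trans_lt ENNReal.zero_lt_top))
  have hnear : IntegrableOn (fun l => (1 + l) ^ (-(1 / 4) : ℝ) * φ l) (Ioc 0 64) := by
    refine hloc.norm.mono' ?_ ?_
    · exact (Measurable.aestronglyMeasurable (by fun_prop)).mul hloc.1
    · refine (ae_restrict_mem measurableSet_Ioc).mono fun l hl => ?_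
      rw [norm_mul, Real.norm_of_nonneg (Real.rpow_nonneg (by linarith [hl.1]) _)]
      exact mul_le_of_le_one_left (norm_nonneg _)
        (Real.rpow_le_one_of_one_le_of_nonpos (by linarith [hl.1]) (by norm_num))
  rw [← Ioc_union_Ioi_eq_Ioi (by norm_num : (0 : ℝ) ≤ 64)]
  refine hnear.union (hfar.congr ?_)
  have h1 : ∀ᵐ l ∂(volume.restrict (Ioi (64 : ℝ))), φ l = ψ l :=
    ae_mono (Measure.restrict_mono (Ioi_subset_Ioi (by norm_num)) le_rfl) hψ
  exact h1.mono fun l hl => by simp [hl]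

/-! ### The Laplace transform of the kernel -/

section CircleIntegral

open scoped Nat

lemma integral_exp_int_mul_I (k : ℤ) (hk : k ≠ 0) :
    ∫ θ in (0 : ℝ)..2 * Real.pi, Complex.exp ((k * Complex.I) * θ) = 0 := by
  have hc : (k : ℂ) * Complex.I ≠ 0 := mul_ne_zero (by exact_mod_cast hk) Complex.I_ne_zero
  rw [integral_exp_mul_complex hc]
  have : Complex.exp ((k * Complex.I) * ((2 * Real.pi : ℝ) : ℂ)) = 1 := by
    rw [← Complex.exp_int_mul_two_pi_mul_I k]
    congr 1
    push_cast
    ring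
  rw [this]
  simp

lemma integral_exp_pow_mul_exp_pow (a b : ℂ) (m n : ℕ) :
    ∫ θ in (0 : ℝ)..2 * Real.pi, (a * Complex.exp (θ * Complex.I)) ^ m / (m ! : ℂ) *
      ((b * Complex.exp (-(θ * Complex.I))) ^ n / (n ! : ℂ)) =
    if m = n then (2 * Real.pi : ℂ) * ((a * b) ^ m / (m ! : ℂ) ^ 2) else 0 := by
  have hval : ∀ θ : ℝ, (a * Complex.exp (θ * Complex.I)) ^ m / (m ! : ℂ) *
      ((b * Complex.exp (-(θ * Complex.I))) ^ n / (n ! : ℂ)) =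
      (a ^ m * b ^ n / ((m ! : ℂ) * (n ! : ℂ))) *
      Complex.exp ((((m : ℤ) - (n : ℤ) : ℤ) * Complex.I) * θ) := fun θ => by
    have : Complex.exp ((((m : ℤ) - (n : ℤ) : ℤ) * Complex.I) * θ) =
        Complex.exp (θ * Complex.I) ^ m * Complex.exp (-(θ * Complex.I)) ^ n := by
      rw [← Complex.exp_nat_mul, ← Complex.exp_nat_mul, ← Complex.exp_add]
      congr 1
      push_cast
      ring
    rw [this, mul_pow, mul_pow]
    ring
  simp only [hval]
  rw [intervalIntegral.integral_const_mul]
  split_ifs with hmn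
  · subst hmn
    simp only [sub_self, Int.cast_zero, zero_mul, Complex.exp_zero,
      intervalIntegral.integral_const, sub_zero, mul_pow, sq, Complex.real_smul]
    push_cast
    ring
  · rw [integral_exp_int_mul_I _ (by simpa [sub_eq_zero] using hmn), mul_zero]

lemma hasSum_mul_of_summable_norm {f g : ℕ → ℂ} {a b : ℂ} (hf : HasSum f a) (hg : HasSum g b)
    (hfn : Summable fun n => ‖f n‖) (hgn : Summable fun n => ‖g n‖) :
    HasSum (fun p : ℕ × ℕ => f p.1 * g p.2) (a * b) :=
  hf.mul hg (summable_mul_of_summable_norm hfn hgn)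

/-- The constant Laurent coefficient of `exp (a w) exp (b / w)`. -/
lemma hasSum_integral_exp_mul_exp (a b : ℂ) :
    HasSum (fun k : ℕ => (2 * Real.pi : ℂ) * ((a * b) ^ k / (k ! : ℂ) ^ 2))
      (∫ θ in (0 : ℝ)..2 * Real.pi, Complex.exp (a * Complex.exp (θ * Complex.I)) *
        Complex.exp (b * Complex.exp (-(θ * Complex.I)))) := by
  set F : ℕ × ℕ → ℝ → ℂ := fun p θ =>
    (a * Complex.exp (θ * Complex.I)) ^ p.1 / (p.1 ! : ℂ) *
      ((b * Complex.exp (-(θ * Complex.I))) ^ p.2 / (p.2 ! : ℂ)) with hF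
  have hexp : ∀ z : ℂ, HasSum (fun n : ℕ => z ^ n / (n ! : ℂ)) (Complex.exp z) := fun z => by
    rw [Complex.exp_eq_exp_ℂ]
    exact NormedSpace.expSeries_div_hasSum_exp z
  have hexpn : ∀ z : ℂ, Summable fun n : ℕ => ‖z ^ n / (n ! : ℂ)‖ := fun z =>
    NormedSpace.norm_expSeries_div_summable z
  have hsum : Summable fun p : ℕ × ℕ => ‖a‖ ^ p.1 / (p.1 ! : ℝ) * (‖b‖ ^ p.2 / (p.2 ! : ℝ)) :=
    (Real.summable_pow_div_factorial ‖a‖).mul_of_nonneg (Real.summable_pow_div_factorial ‖b‖)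
      (fun _ => by positivity) (fun _ => by positivity)
  have hcont : ∀ p, Continuous (F p) := fun p => by simp only [hF]; fun_prop
  have hbound : ∀ (p : ℕ × ℕ) (θ : ℝ),
      ‖F p θ‖ = ‖a‖ ^ p.1 / (p.1 ! : ℝ) * (‖b‖ ^ p.2 / (p.2 ! : ℝ)) := fun p θ => by
    have h1 : ‖Complex.exp (θ * Complex.I)‖ = 1 := Complex.norm_exp_ofReal_mul_I θ
    have h2 : ‖Complex.exp (-(θ * Complex.I))‖ = 1 := by
      simpa using Complex.norm_exp_ofReal_mul_I (-θ)
    simp only [hF, norm_mul, norm_div, norm_pow, h1, h2, mul_one, Complex.norm_natCast]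
  have hprod := fun z w : ℂ => hasSum_mul_of_summable_norm (hexp z) (hexp w) (hexpn z) (hexpn w)
  have key : HasSum (fun p => ∫ θ in (0 : ℝ)..2 * Real.pi, F p θ)
      (∫ θ in (0 : ℝ)..2 * Real.pi, Complex.exp (a * Complex.exp (θ * Complex.I)) *
        Complex.exp (b * Complex.exp (-(θ * Complex.I)))) := by
    refine intervalIntegral.hasSum_integral_of_dominated_convergence
      (fun p _ => ‖a‖ ^ p.1 / (p.1 ! : ℝ) * (‖b‖ ^ p.2 / (p.2 ! : ℝ)))
      (fun p => (hcont p).aestronglyMeasurable) ?_ ?_ ?_ ?_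
    · exact fun p => Filter.Eventually.of_forall fun θ _ => (hbound p θ).le
    · exact Filter.Eventually.of_forall fun θ _ => hsum
    · exact intervalIntegrable_const
    · exact Filter.Eventually.of_forall fun θ _ => hprod _ _
  have hdiag : Function.Injective fun k : ℕ => (k, k) := fun _ _ h => (Prod.ext_iff.1 h).1
  have hoff : ∀ p ∉ range (fun k : ℕ => (k, k)), ∫ θ in (0 : ℝ)..2 * Real.pi, F p θ = 0 := by
    rintro ⟨m, n⟩ hmn
    have : m ≠ n := fun h => hmn ⟨m, by simp [h]⟩
    exact (integral_exp_pow_mul_exp_pow a b m n).trans (if_neg this)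
  have hon : (fun k : ℕ => (2 * Real.pi : ℂ) * ((a * b) ^ k / (k ! : ℂ) ^ 2)) =
      (fun p => ∫ θ in (0 : ℝ)..2 * Real.pi, F p θ) ∘ fun k : ℕ => (k, k) := by
    funext k
    exact ((integral_exp_pow_mul_exp_pow a b k k).trans (if_pos rfl)).symm
  rw [hon]
  exact (hdiag.hasSum_iff hoff).2 key

lemma besselEntire_eq_integral (l y : ℝ) :
    (besselEntire 0 (y ^ 2 + 2 * l * y) : ℂ) = (2 * Real.pi : ℂ)⁻¹ *
      ∫ θ in (0 : ℝ)..2 * Real.pi, Complex.exp (l * Complex.exp (θ * Complex.I)) *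
        Complex.exp (Real.sin θ * Complex.I * y) := by
  have h := hasSum_integral_exp_mul_exp (l + y / 2) (-y / 2)
  have h2 : (2 * Real.pi : ℂ) ≠ 0 := by
    exact_mod_cast mul_ne_zero two_ne_zero Real.pi_ne_zero
  have h3 : ∀ θ : ℝ, Complex.exp ((l + y / 2) * Complex.exp (θ * Complex.I)) *
        Complex.exp ((-y / 2) * Complex.exp (-(θ * Complex.I))) =
      Complex.exp (l * Complex.exp (θ * Complex.I)) *
        Complex.exp (Real.sin θ * Complex.I * y) := fun θ => by
    rw [← Complex.exp_add, ← Complex.exp_add]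
    congr 1
    rw [Complex.ofReal_sin, Complex.sin, neg_mul]
    linear_combination (-(Complex.exp (-(θ * Complex.I)) - Complex.exp (θ * Complex.I)) / 2 * y) * Complex.I_sq
  simp only [h3] at h
  rw [← h.tsum_eq, tsum_mul_left, inv_mul_cancel_left₀ h2, besselEntire, Complex.ofReal_tsum]
  congr 1; ext k
  push_cast
  rw [add_zero, show ((l + y / 2) * (-y / 2) : ℂ) = -1 * ((y ^ 2 + 2 * l * y) / 4) by ring, mul_pow]
  ring

/-- The Laplace transform in `y` of `J₀(√(y² + 2 l y))` at `s = (1/ξ - ξ) / 2`: by the circle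
integral of `besselEntire_eq_integral` it is a Cauchy integral with its only pole inside the unit
circle at `-ξ`. -/
lemma laplaceTransform_besselEntire_path {ξ : ℝ} (hξ : 0 < ξ) (hξ1 : ξ < 1) (l : ℝ) :
    1 / 2 * (ξ + 1 / ξ) *
      laplaceTransform (fun y => besselEntire 0 (y ^ 2 + 2 * l * y)) (1 / 2 * (1 / ξ - ξ)) =
      Real.exp (-(ξ * l)) := by
  set s : ℝ := 1 / 2 * (1 / ξ - ξ) with hs_def
  have hs : 0 < s := by
    have : 1 < 1 / ξ := by rw [lt_div_iff₀ hξ]; linarith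
    rw [hs_def]; linarith
  set h : ℝ → ℝ → ℂ := fun y θ => Complex.exp (l * Complex.exp (θ * Complex.I)) *
    Complex.exp ((-s + Real.sin θ * Complex.I) * y) with hh
  have hle : (0 : ℝ) ≤ 2 * Real.pi := by positivity
  have hL : (laplaceTransform (fun y => besselEntire 0 (y ^ 2 + 2 * l * y)) s : ℂ) =
      (2 * Real.pi : ℂ)⁻¹ * ∫ y in Ioi (0 : ℝ), ∫ θ in Ioc 0 (2 * Real.pi), h y θ := by
    rw [laplaceTransform, ← integral_complex_ofReal, ← integral_const_mul]
    refine setIntegral_congr_fun measurableSet_Ioi fun y _ => ?_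
    simp only [Complex.ofReal_mul]
    rw [besselEntire_eq_integral, mul_left_comm, ← intervalIntegral.integral_const_mul,
      intervalIntegral.integral_of_le hle]
    congr 1
    refine integral_congr_ae (Filter.Eventually.of_forall fun θ => ?_)
    simp only [hh, add_mul, Complex.exp_add]
    push_cast
    ring_nf
  have hint : Integrable (Function.uncurry h)
      ((volume.restrict (Ioi 0)).prod (volume.restrict (Ioc 0 (2 * Real.pi)))) := by
    have h1 : IntegrableOn (fun y : ℝ => Real.exp (-s * y)) (Ioi 0) :=
      integrableOn_exp_mul_Ioi (by linarith) 0
    have h2 : IntegrableOn (fun _ : ℝ => Real.exp |l|) (Ioc 0 (2 * Real.pi)) :=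
      continuous_const.integrableOn_Ioc
    refine (Integrable.mul_prod h1 h2).mono' ?_ (Filter.Eventually.of_forall fun p => ?_)
    · have : Continuous (Function.uncurry h) := by
        simp only [hh, Function.uncurry_def]; fun_prop
      exact this.aestronglyMeasurable
    · simp only [Function.uncurry_def, hh, norm_mul, Complex.norm_exp]
      rw [mul_comm]
      have h3 : ((l : ℂ) * Complex.exp (p.2 * Complex.I)).re ≤ |l| := by
        refine (Complex.re_le_norm _).trans ?_
        rw [norm_mul, Complex.norm_exp_ofReal_mul_I, mul_one, Complex.norm_real, Real.norm_eq_abs]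
      have h4 : ((-(s : ℂ) + Real.sin p.2 * Complex.I) * p.1).re = -s * p.1 := by simp
      rw [h4]
      gcongr
  have hinner : ∀ θ : ℝ, ∫ y in Ioi (0 : ℝ), h y θ =
      Complex.exp (l * Complex.exp (θ * Complex.I)) / (s - Real.sin θ * Complex.I) := fun θ => by
    simp only [hh]
    rw [integral_const_mul, integral_exp_mul_complex_Ioi (by simpa using hs)]
    rw [Complex.ofReal_zero, mul_zero, Complex.exp_zero, neg_div, ← div_neg, neg_add, neg_neg,
      mul_one_div, ← sub_eq_add_neg]
  rw [integral_integral_swap hint] at hL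
  simp only [hinner] at hL
  rw [← intervalIntegral.integral_of_le hle] at hL
  -- Cauchy's formula for `w ↦ 2 exp (l w) / (1/ξ - w)` at the point `-ξ`.
  have hξc : (ξ : ℂ) ≠ 0 := by exact_mod_cast hξ.ne'
  have hne : ∀ w ∈ Metric.closedBall (0 : ℂ) 1, (1 : ℂ) / ξ - w ≠ 0 := fun w hw h0 => by
    have h1 : ‖w‖ ≤ 1 := by simpa using hw
    rw [← sub_eq_zero.1 h0, norm_div, norm_one, Complex.norm_real, Real.norm_of_nonneg hξ.le,
      div_le_one hξ] at h1
    linarith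
  have hd : DiffContOnCl ℂ (fun w : ℂ => 2 * Complex.exp (l * w) / (1 / ξ - w))
      (Metric.ball 0 1) := by
    refine DifferentiableOn.diffContOnCl fun w hw => ?_
    rw [closure_ball _ one_ne_zero] at hw
    have := hne w hw
    refine DifferentiableAt.differentiableWithinAt ?_
    fun_prop (disch := assumption)
  have hc := hd.two_pi_i_inv_smul_circleIntegral_sub_inv_smul (w := -(ξ : ℂ))
    (by simpa [abs_of_pos hξ] using hξ1)
  have hcirc : (2 * Real.pi * Complex.I : ℂ)⁻¹ • (∮ w in C(0, 1), (w - (-(ξ : ℂ)))⁻¹ •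
      (2 * Complex.exp (l * w) / (1 / ξ - w))) =
      (laplaceTransform (fun y => besselEntire 0 (y ^ 2 + 2 * l * y)) s : ℂ) := by
    rw [hL, circleIntegral, smul_eq_mul, mul_inv, mul_assoc, ← intervalIntegral.integral_const_mul]
    congr 1
    refine intervalIntegral.integral_congr fun θ _ => ?_
    simp only [deriv_circleMap, circleMap, Complex.ofReal_one, one_mul, zero_add, smul_eq_mul]
    set w := Complex.exp (θ * Complex.I) with hw
    have hw0 : w ≠ 0 := Complex.exp_ne_zero _
    have hwn : ‖w‖ = 1 := Complex.norm_exp_ofReal_mul_I θ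
    have h1 := hne w (by simp [hwn])
    have h2 : w + ξ ≠ 0 := fun h0 => by
      have h3 : ‖w‖ = ξ := by
        rw [eq_neg_of_add_eq_zero_left h0, norm_neg, Complex.norm_real, Real.norm_of_nonneg hξ.le]
      linarith
    have h3 : (s : ℂ) - Real.sin θ * Complex.I = (w + ξ) * (1 / ξ - w) / (2 * w) := by
      rw [Complex.ofReal_sin, Complex.sin, neg_mul, Complex.exp_neg, ← hw, hs_def]
      push_cast
      field_simp
      linear_combination (ξ * w ^ 2 - ξ) * Complex.I_sq
    have h4 : (ξ : ℂ)⁻¹ - w ≠ 0 := by simpa using h1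
    rw [h3, sub_neg_eq_add, one_div]
    have hI := Complex.I_ne_zero
    field_simp
  rw [hcirc] at hc
  have hval : 2 * Complex.exp (l * -(ξ : ℂ)) / (1 / ξ - -ξ) =
      ((2 * Real.exp (-(ξ * l)) / (1 / ξ + ξ) : ℝ) : ℂ) := by
    push_cast
    rw [sub_neg_eq_add, mul_comm (l : ℂ), neg_mul]
  rw [hval] at hc
  rw [Complex.ofReal_injective hc]
  field_simp
  ring

end CircleIntegral

/-! ### Uniqueness of the Laplace transform -/

lemma setIntegral_polynomial_exp_neg_eq_zero {k : ℝ → ℝ} (hk : IntegrableOn k (Ioi 0))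
    (h : ∀ n : ℕ, ∫ y in Ioi (0 : ℝ), Real.exp (-y) ^ n * k y = 0) (p : Polynomial ℝ) :
    ∫ y in Ioi (0 : ℝ), p.eval (Real.exp (-y)) * k y = 0 := by
  have hint : ∀ n : ℕ, IntegrableOn (fun y => Real.exp (-y) ^ n * k y) (Ioi 0) := fun n => by
    refine hk.norm.mono' ?_ ?_
    · exact (Continuous.aestronglyMeasurable (by fun_prop)).mul hk.1
    · refine (ae_restrict_mem measurableSet_Ioi).mono fun y hy => ?_
      rw [norm_mul, norm_pow, Real.norm_of_nonneg (Real.exp_pos _).le]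
      refine mul_le_of_le_one_left (norm_nonneg _) (pow_le_one₀ (Real.exp_pos _).le ?_)
      exact Real.exp_le_one_iff.2 (by linarith [mem_Ioi.1 hy])
  simp only [Polynomial.eval_eq_sum_range, Finset.sum_mul, mul_assoc]
  rw [integral_finsetSum _ fun n _ => (hint n).const_mul _]
  exact Finset.sum_eq_zero fun n _ => by rw [integral_const_mul, h, mul_zero]

lemma setIntegral_comp_exp_neg_eq_zero {k : ℝ → ℝ} (hk : IntegrableOn k (Ioi 0))
    (h : ∀ n : ℕ, ∫ y in Ioi (0 : ℝ), Real.exp (-y) ^ n * k y = 0) {ψ : ℝ → ℝ}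
    (hψ : ContinuousOn ψ (Icc 0 1)) :
    ∫ y in Ioi (0 : ℝ), ψ (Real.exp (-y)) * k y = 0 := by
  set I := ∫ y in Ioi (0 : ℝ), ‖k y‖
  have hI : 0 ≤ I := integral_nonneg fun _ => norm_nonneg _
  have hmem : ∀ y ∈ Ioi (0 : ℝ), Real.exp (-y) ∈ Icc (0 : ℝ) 1 := fun y hy =>
    ⟨(Real.exp_pos _).le, Real.exp_le_one_iff.2 (by linarith [mem_Ioi.1 hy])⟩
  have hmeas : ∀ {θ : ℝ → ℝ}, ContinuousOn θ (Icc 0 1) →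
      AEStronglyMeasurable (fun y => θ (Real.exp (-y)) * k y) (volume.restrict (Ioi 0)) :=
    fun hθ => ((hθ.comp (Continuous.continuousOn (by fun_prop)) hmem).aestronglyMeasurable
      measurableSet_Ioi).mul hk.1
  refine abs_eq_zero.1 (le_antisymm (le_of_forall_pos_le_add fun ε hε => ?_) (abs_nonneg _))
  obtain ⟨p, hp⟩ := exists_polynomial_near_of_continuousOn 0 1 ψ hψ (ε / (I + 1)) (by positivity)
  have hb : ∀ y ∈ Ioi (0 : ℝ), ‖ψ (Real.exp (-y)) * k y - p.eval (Real.exp (-y)) * k y‖ ≤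
      ε / (I + 1) * ‖k y‖ := fun y hy => by
    rw [← sub_mul, norm_mul, norm_sub_rev]
    gcongr
    exact (hp _ (hmem y hy)).le
  have hp' : ContinuousOn (fun x => p.eval x) (Icc 0 1) := p.continuous.continuousOn
  have hd : IntegrableOn
      (fun y => ψ (Real.exp (-y)) * k y - p.eval (Real.exp (-y)) * k y) (Ioi 0) :=
    (hk.norm.const_mul _).mono' ((hmeas hψ).sub (hmeas hp'))
      ((ae_restrict_mem measurableSet_Ioi).mono hb)
  obtain ⟨M, hM⟩ := isCompact_Icc.exists_bound_of_continuousOn hp'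
  have hpi : IntegrableOn (fun y => p.eval (Real.exp (-y)) * k y) (Ioi 0) :=
    (hk.norm.const_mul M).mono' (hmeas hp')
      ((ae_restrict_mem measurableSet_Ioi).mono fun y hy => by
        rw [norm_mul]; gcongr; exact hM _ (hmem y hy))
  have he : ∫ y in Ioi (0 : ℝ), ψ (Real.exp (-y)) * k y =
      ∫ y in Ioi (0 : ℝ), (ψ (Real.exp (-y)) * k y - p.eval (Real.exp (-y)) * k y) := by
    have := integral_add hd hpi
    simp only [sub_add_cancel] at this
    rw [this, setIntegral_polynomial_exp_neg_eq_zero hk h p, add_zero]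
  rw [he, ← Real.norm_eq_abs, zero_add]
  calc _ ≤ ∫ y in Ioi (0 : ℝ), ε / (I + 1) * ‖k y‖ :=
        norm_integral_le_of_norm_le (hk.norm.const_mul _)
          ((ae_restrict_mem measurableSet_Ioi).mono hb)
    _ = ε / (I + 1) * I := integral_const_mul _ _
    _ ≤ ε := by
      rw [div_mul_eq_mul_div, div_le_iff₀ (by positivity)]
      nlinarith

/-- Lerch's uniqueness theorem in its moment form: `x = exp (-y)` turns it into the determinacy of
the moment problem on `[0, 1]`. -/
lemma eq_zero_of_setIntegral_exp_neg_pow_eq_zero {k : ℝ → ℝ} (hk : IntegrableOn k (Ioi 0))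
    (hc : ContinuousOn k (Ioi 0))
    (h : ∀ n : ℕ, ∫ y in Ioi (0 : ℝ), Real.exp (-y) ^ n * k y = 0) {y : ℝ} (hy : 0 < y) :
    k y = 0 := by
  have hae : ∀ᵐ y, y ∈ Ioi (0 : ℝ) → k y = 0 := by
    refine isOpen_Ioi.ae_eq_zero_of_integral_contDiff_smul_eq_zero hk.locallyIntegrableOn
      fun g hg hgc hgs => ?_
    have hz : ∀ y ∉ Ioi (0 : ℝ), g y = 0 := fun y hy =>
      image_eq_zero_of_notMem_tsupport fun hy' => hy (hgs hy')
    have hψ : Continuous fun x => g (-Real.log x) := by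
      refine continuous_iff_continuousAt.2 fun x => ?_
      rcases eq_or_ne x 0 with rfl | hx
      · rw [continuousAt_iff_punctured_nhds]
        have h0 : g (-Real.log 0) = 0 := by simpa using hz 0 (by simp)
        rw [h0]
        have h1 : Filter.Tendsto (fun x => -Real.log x) (nhdsWithin 0 {0}ᶜ)
            (Filter.cocompact ℝ) :=
          (Filter.tendsto_neg_atBot_atTop.comp Real.tendsto_log_nhdsNE_zero).mono_right
            atTop_le_cocompact
        exact hgc.is_zero_at_infty.comp h1
      · exact hg.continuous.continuousAt.comp (Real.continuousAt_log hx).neg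
    have := setIntegral_comp_exp_neg_eq_zero hk h hψ.continuousOn
    simp only [Real.log_exp, neg_neg] at this
    rw [← this]
    refine (setIntegral_eq_integral_of_forall_compl_eq_zero fun y hy => ?_).symm
    rw [hz y hy, zero_smul]
  have h2 := Measure.eqOn_open_of_ae_eq (f := k) (g := fun _ => (0 : ℝ)) (μ := volume)
    ((ae_restrict_iff' measurableSet_Ioi).2 hae) isOpen_Ioi hc continuousOn_const
  exact h2 hy

lemma eq_of_laplaceTransform_eq {f g : ℝ → ℝ} (hf : ContinuousOn f (Ioi 0))
    (hg : ContinuousOn g (Ioi 0)) {s₁ : ℝ} (hfL : ∀ s > s₁, LaplaceConverges f s)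
    (hgL : ∀ s > s₁, LaplaceConverges g s)
    (h : ∀ s > s₁, laplaceTransform f s = laplaceTransform g s) {y : ℝ} (hy : 0 < y) :
    f y = g y := by
  set s := s₁ + 1
  have hs : s₁ < s := lt_add_one _
  have hfi := hfL s hs
  have hgi := hgL s hs
  have key := eq_zero_of_setIntegral_exp_neg_pow_eq_zero
    (k := fun y => Real.exp (-(s * y)) * f y - Real.exp (-(s * y)) * g y) (hfi.sub hgi)
    (((Continuous.continuousOn (by fun_prop)).mul hf).sub
      ((Continuous.continuousOn (by fun_prop)).mul hg)) (fun n => ?_) hy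
  · have : Real.exp (-(s * y)) * (f y - g y) = 0 := by rw [mul_sub]; exact key
    exact sub_eq_zero.1 ((mul_eq_zero.1 this).resolve_left (Real.exp_pos _).ne')
  · have hsn : s₁ < s + n := by
      have : (0 : ℝ) ≤ n := n.cast_nonneg
      linarith
    have hfn : IntegrableOn (fun y => Real.exp (-((s + n) * y)) * f y) (Ioi 0) := hfL _ hsn
    have hgn : IntegrableOn (fun y => Real.exp (-((s + n) * y)) * g y) (Ioi 0) := hgL _ hsn
    have h1 := integral_sub (μ := volume.restrict (Ioi 0)) hfn hgn
    have h2 := sub_eq_zero.2 (h _ hsn)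
    simp only [laplaceTransform] at h2
    rw [h2] at h1
    refine Eq.trans ?_ h1
    refine setIntegral_congr_fun measurableSet_Ioi fun y _ => ?_
    have : Real.exp (-((s + n) * y)) = Real.exp (-y) ^ n * Real.exp (-(s * y)) := by
      rw [← Real.exp_nat_mul, ← Real.exp_add]; congr 1; ring
    simp only [this]
    ring

/-! ### Continuity and initial values of the superposition -/

lemma rpow_neg_one_add_path_le {α m q l A : ℝ} (hα : 0 ≤ α) (hm : 0 < m) (hm1 : m ≤ 1)
    (hq : m ≤ q) (hl : 0 ≤ l) (hA : 0 ≤ A) :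
    (1 + (A + l * q)) ^ (-α) ≤ m ^ (-α) * (1 + l) ^ (-α) := by
  rw [← Real.mul_rpow hm.le (by linarith)]
  refine Real.rpow_le_rpow_of_nonpos (by positivity) ?_ (neg_nonpos.2 hα)
  nlinarith [mul_le_mul_of_nonneg_left hq hl]

lemma besselKernel_eq {y l : ℝ} (hy : 0 < y) (hl : 0 ≤ l) (t : ℝ) :
    besselKernel y t l = besselEntire 0 (y ^ 2 + l * (2 * y * Real.exp t)) +
      besselEntire 0 (y ^ 2 + l * (2 * y * Real.exp (-t))) := by
  rw [besselKernel, besselJ0_sqrt (by positivity), besselJ0_sqrt (by positivity)]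
  congr 2 <;> ring

lemma besselKernel_zero_right {y l : ℝ} (hy : 0 < y) (hl : 0 ≤ l) :
    besselKernel y 0 l = 2 * besselEntire 0 (y ^ 2 + 2 * l * y) := by
  rw [besselKernel_eq hy hl, neg_zero, Real.exp_zero, ← two_mul]
  ring_nf

/-- On `{y ≥ a, |t| ≤ T}` the kernel decays like `l ^ (-1/4)`, uniformly. -/
lemma exists_besselKernel_bound {a : ℝ} (ha : 0 < a) (T : ℝ) :
    ∃ C > 0, ∀ y t l : ℝ, a ≤ y → |t| ≤ T → 0 ≤ l →
      |besselKernel y t l| ≤ C * (1 + l) ^ (-(1 / 4) : ℝ) := by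
  obtain ⟨C, hC, h⟩ := exists_besselEntire_zero_bound
  set m := min 1 (a * Real.exp (-T))
  have hm : 0 < m := lt_min one_pos (by positivity)
  refine ⟨2 * (C * m ^ (-(1 / 4) : ℝ)), by positivity, fun y t l hy ht hl => ?_⟩
  have hy0 : 0 < y := ha.trans_le hy
  have key : ∀ τ : ℝ, |τ| ≤ T → |besselEntire 0 (y ^ 2 + l * (2 * y * Real.exp τ))| ≤
      C * m ^ (-(1 / 4) : ℝ) * (1 + l) ^ (-(1 / 4) : ℝ) := fun τ hτ => by
    refine (h _ (by positivity)).trans ?_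
    rw [mul_assoc C]
    gcongr
    refine rpow_neg_one_add_path_le (α := 1 / 4) (by norm_num) hm (min_le_left _ _) ?_ hl (by positivity)
    calc m ≤ a * Real.exp (-T) := min_le_right _ _
      _ ≤ (2 * y) * Real.exp τ :=
        mul_le_mul (by linarith) (Real.exp_le_exp.2 (by linarith [(abs_le.1 hτ).1]))
          (Real.exp_pos _).le (by linarith)
  rw [besselKernel_eq hy0 hl]
  refine (abs_add_le _ _).trans ?_
  have h1 := key t ht
  have h2 := key (-t) (by rwa [abs_neg])
  linarith

lemma continuous_besselEntire_kernel :
    Continuous fun p : (ℝ × ℝ) × ℝ =>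
      besselEntire 0 (p.1.1 ^ 2 + p.2 * (2 * p.1.1 * Real.exp p.1.2)) +
      besselEntire 0 (p.1.1 ^ 2 + p.2 * (2 * p.1.1 * Real.exp (-p.1.2))) :=
  ((continuous_besselEntire 0).comp (by fun_prop)).add
    ((continuous_besselEntire 0).comp (by fun_prop))

lemma aestronglyMeasurable_mul_besselKernel {φ : ℝ → ℝ}
    (hφ : AEStronglyMeasurable φ (volume.restrict (Ioi 0))) {y : ℝ} (hy : 0 < y) (t : ℝ) :
    AEStronglyMeasurable (fun l => φ l * besselKernel y t l) (volume.restrict (Ioi 0)) := by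
  have : Continuous fun l => besselEntire 0 (y ^ 2 + l * (2 * y * Real.exp t)) +
      besselEntire 0 (y ^ 2 + l * (2 * y * Real.exp (-t))) :=
    continuous_besselEntire_kernel.comp (f := fun l => ((y, t), l)) (by fun_prop)
  refine (hφ.mul this.aestronglyMeasurable).congr ?_
  refine (ae_restrict_mem measurableSet_Ioi).mono fun l hl => ?_
  simp only [Pi.mul_apply, besselKernel_eq hy (le_of_lt hl)]

lemma continuousAt_besselSolution {φ : ℝ → ℝ}
    (hφ : AEStronglyMeasurable φ (volume.restrict (Ioi 0)))
    (hw : IntegrableOn (fun l => (1 + l) ^ (-(1 / 4) : ℝ) * φ l) (Ioi 0)) {p : ℝ × ℝ}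
    (hp : 0 < p.1) : ContinuousAt (fun p : ℝ × ℝ => besselSolution φ p.1 p.2) p := by
  obtain ⟨C, hC, hb⟩ := exists_besselKernel_bound (half_pos hp) (|p.2| + 1)
  have hnear : ∀ᶠ q : ℝ × ℝ in nhds p, p.1 / 2 < q.1 ∧ |q.2| < |p.2| + 1 :=
    (continuous_fst.continuousAt.eventually (lt_mem_nhds (half_lt_self hp))).and
      ((continuous_snd.abs.continuousAt).eventually (gt_mem_nhds (lt_add_one _)))
  refine ContinuousAt.mul continuousAt_const ?_
  refine continuousAt_of_dominated
    (bound := fun l => C * ‖(1 + l) ^ (-(1 / 4) : ℝ) * φ l‖) ?_ ?_ (hw.norm.const_mul C) ?_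
  · exact hnear.mono fun q hq =>
      aestronglyMeasurable_mul_besselKernel hφ ((half_pos hp).trans hq.1) q.2
  · refine hnear.mono fun q hq => (ae_restrict_mem measurableSet_Ioi).mono fun l hl => ?_
    have hl0 : (0 : ℝ) ≤ l := le_of_lt hl
    rw [norm_mul, norm_mul, Real.norm_of_nonneg (Real.rpow_nonneg (by linarith) _), ← mul_assoc,
      mul_comm]
    gcongr
    exact hb q.1 q.2 l hq.1.le hq.2.le hl0
  · refine (ae_restrict_mem measurableSet_Ioi).mono fun l hl => ?_
    have hc : ContinuousAt (fun q : ℝ × ℝ =>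
        φ l * (besselEntire 0 (q.1 ^ 2 + l * (2 * q.1 * Real.exp q.2)) +
        besselEntire 0 (q.1 ^ 2 + l * (2 * q.1 * Real.exp (-q.2))))) p :=
      (continuous_const.mul (continuous_besselEntire_kernel.comp
        (f := fun q : ℝ × ℝ => (q, l)) (by fun_prop))).continuousAt
    refine hc.congr (hnear.mono fun q hq => ?_)
    simp only [besselKernel_eq ((half_pos hp).trans hq.1) (le_of_lt hl)]

lemma besselSolution_zero_right (φ : ℝ → ℝ) {y : ℝ} (hy : 0 < y) :
    besselSolution φ y 0 = ∫ l in Ioi (0 : ℝ), φ l * besselEntire 0 (y ^ 2 + 2 * l * y) := by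
  rw [besselSolution, ← integral_const_mul]
  refine setIntegral_congr_fun measurableSet_Ioi fun l hl => ?_
  simp only [besselKernel_zero_right hy (le_of_lt hl)]
  ring

lemma integrable_exp_mul_besselEntire_prod {φ : ℝ → ℝ}
    (hφ : AEStronglyMeasurable φ (volume.restrict (Ioi 0)))
    (hw : IntegrableOn (fun l => (1 + l) ^ (-(1 / 4) : ℝ) * φ l) (Ioi 0)) {s : ℝ} (hs : 0 < s) :
    Integrable (Function.uncurry fun y l : ℝ =>
      Real.exp (-(s * y)) * (φ l * besselEntire 0 (y ^ 2 + 2 * l * y)))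
      ((volume.restrict (Ioi 0)).prod (volume.restrict (Ioi 0))) := by
  obtain ⟨C, hC, h⟩ := exists_besselEntire_zero_bound
  have h1 : IntegrableOn (fun y : ℝ => Real.exp (-(s * y)) + y ^ (-(1 / 4) : ℝ) *
      Real.exp (-(s * y))) (Ioi 0) := by
    refine IntegrableOn.add ?_ ?_
    · simpa using integrableOn_exp_mul_Ioi (neg_lt_zero.2 hs) 0
    · simpa using integrableOn_rpow_mul_exp_neg_mul_rpow (p := 1) (s := -(1 / 4))
        (by norm_num) one_pos hs
  refine ((h1.const_mul C).mul_prod hw.norm).mono' ?_ ?_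
  · have h2 : Continuous fun p : ℝ × ℝ => besselEntire 0 (p.1 ^ 2 + 2 * p.2 * p.1) :=
      (continuous_besselEntire 0).comp (by fun_prop)
    exact (Continuous.aestronglyMeasurable (by fun_prop)).mul
      (hφ.comp_snd.mul h2.aestronglyMeasurable)
  · rw [Measure.prod_restrict]
    refine (ae_restrict_mem (measurableSet_Ioi.prod measurableSet_Ioi)).mono fun p hp => ?_
    obtain ⟨y, l⟩ := p
    have hy : 0 < y := hp.1
    have hl : 0 < l := hp.2
    simp only [Function.uncurry_apply_pair]
    rw [norm_mul, norm_mul, norm_mul, Real.norm_of_nonneg (Real.exp_pos _).le,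
      Real.norm_of_nonneg (Real.rpow_nonneg (by linarith) _)]
    have h3 : ‖besselEntire 0 (y ^ 2 + 2 * l * y)‖ ≤
        C * ((1 + y ^ (-(1 / 4) : ℝ)) * (1 + l) ^ (-(1 / 4) : ℝ)) := by
      refine (h _ (by positivity)).trans ?_
      gcongr
      have h4 := rpow_neg_one_add_path_le (α := 1 / 4) (m := min 1 y) (q := 2 * y) (l := l)
        (A := y ^ 2) (by norm_num) (lt_min one_pos hy) (min_le_left _ _)
        ((min_le_right _ _).trans (by linarith)) hl.le (by positivity)
      rw [show y ^ 2 + 2 * l * y = y ^ 2 + l * (2 * y) by ring]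
      refine h4.trans ?_
      gcongr
      rcases le_total 1 y with h5 | h5
      · rw [min_eq_left h5, Real.one_rpow]
        have : 0 ≤ y ^ (-(1 / 4) : ℝ) := by positivity
        linarith
      · rw [min_eq_right h5]
        linarith
    calc Real.exp (-(s * y)) * (‖φ l‖ * ‖besselEntire 0 (y ^ 2 + 2 * l * y)‖)
        ≤ Real.exp (-(s * y)) * (‖φ l‖ *
          (C * ((1 + y ^ (-(1 / 4) : ℝ)) * (1 + l) ^ (-(1 / 4) : ℝ)))) := by gcongr
      _ = _ := by ring

lemma laplaceTransform_besselSolution {φ : ℝ → ℝ}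
    (hφ : AEStronglyMeasurable φ (volume.restrict (Ioi 0)))
    (hw : IntegrableOn (fun l => (1 + l) ^ (-(1 / 4) : ℝ) * φ l) (Ioi 0)) {ξ : ℝ} (hξ : 0 < ξ)
    (hξ1 : ξ < 1) :
    LaplaceConverges (fun y => besselSolution φ y 0) (1 / 2 * (1 / ξ - ξ)) ∧
      1 / 2 * (ξ + 1 / ξ) * laplaceTransform (fun y => besselSolution φ y 0)
        (1 / 2 * (1 / ξ - ξ)) = laplaceTransform φ ξ := by
  set s : ℝ := 1 / 2 * (1 / ξ - ξ) with hs_def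
  have hs : 0 < s := by
    have : 1 < 1 / ξ := by rw [lt_div_iff₀ hξ]; linarith
    rw [hs_def]; linarith
  have hint := integrable_exp_mul_besselEntire_prod hφ hw hs
  have hin : ∀ y ∈ Ioi (0 : ℝ), ∫ l in Ioi (0 : ℝ),
      Real.exp (-(s * y)) * (φ l * besselEntire 0 (y ^ 2 + 2 * l * y)) =
      Real.exp (-(s * y)) * besselSolution φ y 0 := fun y hy => by
    rw [integral_const_mul, besselSolution_zero_right φ hy]
  refine ⟨?_, ?_⟩
  · exact hint.integral_prod_left.congr ((ae_restrict_mem measurableSet_Ioi).mono hin)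
  · have h1 : laplaceTransform (fun y => besselSolution φ y 0) s = ∫ l in Ioi (0 : ℝ),
        φ l * laplaceTransform (fun y => besselEntire 0 (y ^ 2 + 2 * l * y)) s := by
      rw [laplaceTransform, ← setIntegral_congr_fun measurableSet_Ioi hin,
        integral_integral_swap hint]
      refine integral_congr_ae (Filter.Eventually.of_forall fun l => ?_)
      simp only [laplaceTransform]
      rw [← integral_const_mul]
      refine integral_congr_ae (Filter.Eventually.of_forall fun y => ?_)
      simp only
      ring
    rw [h1, ← integral_const_mul, laplaceTransform]
    refine integral_congr_ae (Filter.Eventually.of_forall fun l => ?_)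
    simp only
    rw [← laplaceTransform_besselEntire_path hξ hξ1 l]
    ring

/-- For `s > 0`, the number `ξ = √(s² + 1) - s` is the solution of `(1/ξ - ξ) / 2 = s` in
`(0, 1)`. -/
lemma exists_half_inv_sub_eq {s : ℝ} (hs : 0 < s) :
    ∃ ξ : ℝ, 0 < ξ ∧ ξ < 1 ∧ 1 / 2 * (1 / ξ - ξ) = s := by
  have h1 : √(s ^ 2 + 1) ^ 2 = s ^ 2 + 1 := Real.sq_sqrt (by positivity)
  have h0 : 0 ≤ √(s ^ 2 + 1) := Real.sqrt_nonneg _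
  have h2 : s < √(s ^ 2 + 1) := by nlinarith
  have h3 : √(s ^ 2 + 1) - s ≠ 0 := by linarith
  refine ⟨√(s ^ 2 + 1) - s, by linarith, by nlinarith, ?_⟩
  field_simp
  linear_combination -h1

section InitialValue

variable {f φ : ℝ → ℝ} {s₀ : ℝ}

lemma exists_laplaceConverges_of_isInverseLaplaceOn {G : ℝ → ℝ}
    (hφ : IsInverseLaplaceOn φ G {ξ | 0 < ξ ∧ s₀ < 1 / 2 * (1 / ξ - ξ)}) :
    ∃ ξ > 0, LaplaceConverges φ ξ := by
  obtain ⟨ξ, h0, -, h⟩ := exists_half_inv_sub_eq (s := |s₀| + 1) (by positivity)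
  refine ⟨ξ, h0, (hφ ξ ⟨h0, ?_⟩).1⟩
  rw [h]
  linarith [le_abs_self s₀]

lemma aestronglyMeasurable_of_laplaceConverges {ξ : ℝ} (h : LaplaceConverges φ ξ) :
    AEStronglyMeasurable φ (volume.restrict (Ioi 0)) := by
  have h1 : Continuous fun l => Real.exp (ξ * l) := by fun_prop
  refine (h1.aestronglyMeasurable.mul h.1).congr (Filter.Eventually.of_forall fun l => ?_)
  simp only [Pi.mul_apply]
  rw [← mul_assoc, ← Real.exp_add, add_neg_cancel, Real.exp_zero, one_mul]

lemma integrableOn_Ioc_of_laplaceConverges {ξ : ℝ} (hξ : 0 < ξ) (h : LaplaceConverges φ ξ)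
    (b : ℝ) : IntegrableOn φ (Ioc 0 b) := by
  have hsub : Ioc (0 : ℝ) b ⊆ Ioi 0 := Ioc_subset_Ioi_self
  have h' : IntegrableOn (fun y => Real.exp (-(ξ * y)) * φ y) (Ioc 0 b) := IntegrableOn.mono_set h hsub
  refine (h'.norm.const_mul (Real.exp (ξ * b))).mono'
    ((aestronglyMeasurable_of_laplaceConverges h).mono_measure
      (Measure.restrict_mono hsub le_rfl)) ?_
  refine (ae_restrict_mem measurableSet_Ioc).mono fun l hl => ?_
  rw [norm_mul, Real.norm_of_nonneg (Real.exp_pos _).le, ← mul_assoc, ← Real.exp_add]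
  refine le_mul_of_one_le_left (norm_nonneg _) (Real.one_le_exp ?_)
  nlinarith [mul_le_mul_of_nonneg_left hl.2 hξ.le]

lemma besselSolution_zero_eq (hf : ContinuousOn f (Ioi 0)) (hF : ∀ s > s₀, LaplaceConverges f s)
    (hφ : IsInverseLaplaceOn φ
      (fun ξ => 1 / 2 * (ξ + 1 / ξ) * laplaceTransform f (1 / 2 * (1 / ξ - ξ)))
      {ξ | 0 < ξ ∧ s₀ < 1 / 2 * (1 / ξ - ξ)})
    (hφm : AEStronglyMeasurable φ (volume.restrict (Ioi 0)))
    (hw : IntegrableOn (fun l => (1 + l) ^ (-(1 / 4) : ℝ) * φ l) (Ioi 0)) {y : ℝ} (hy : 0 < y) :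
    besselSolution φ y 0 = f y := by
  have hc : ContinuousOn (fun y => besselSolution φ y 0) (Ioi 0) := fun z hz =>
    (ContinuousAt.comp (f := fun z : ℝ => (z, (0 : ℝ))) (continuousAt_besselSolution hφm hw hz)
      (by fun_prop)).continuousWithinAt
  refine eq_of_laplaceTransform_eq (s₁ := max s₀ 0) hc hf (fun s hs => ?_)
    (fun s hs => hF s ((le_max_left _ _).trans_lt hs)) (fun s hs => ?_) hy
  · obtain ⟨ξ, h0, h1, h⟩ := exists_half_inv_sub_eq ((le_max_right s₀ 0).trans_lt hs)
    rw [← h]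
    exact (laplaceTransform_besselSolution hφm hw h0 h1).1
  · obtain ⟨ξ, h0, h1, h⟩ := exists_half_inv_sub_eq ((le_max_right s₀ 0).trans_lt hs)
    have h2 := (laplaceTransform_besselSolution hφm hw h0 h1).2
    have h3 := (hφ ξ ⟨h0, by rw [h]; exact (le_max_left _ _).trans_lt hs⟩).2
    rw [h3, h] at h2
    have hne : 1 / 2 * (ξ + 1 / ξ) ≠ 0 := by positivity
    exact mul_left_cancel₀ hne (by simpa only [h] using h2)

end InitialValue

/-! ### Partial derivatives and Green's formula -/

/-- The residual `u_tt - (y² u_yy + y u_y + y² u)` of the equation at `(y, t)`. -/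
noncomputable def waveOperator (u : ℝ → ℝ → ℝ) (y t : ℝ) : ℝ :=
  iteratedDeriv 2 (fun τ => u y τ) t -
    (y ^ 2 * iteratedDeriv 2 (fun z => u z t) y + y * deriv (fun z => u z t) y + y ^ 2 * u y t)

/-- The formal adjoint `η_tt - ((y² η)_yy - (y η)_y + y² η)` of `waveOperator`, at `(y, t)`. -/
noncomputable def waveAdjoint (η : ℝ → ℝ → ℝ) (y t : ℝ) : ℝ :=
  iteratedDeriv 2 (fun τ => η y τ) t -
    (iteratedDeriv 2 (fun z => z ^ 2 * η z t) y - deriv (fun z => z * η z t) y + y ^ 2 * η y t)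

/-- The derivative of `W` in the direction `v`. The two partial derivatives are `v = (1, 0)` and
`v = (0, 1)`. -/
noncomputable def dirDeriv (v : ℝ × ℝ) (W : ℝ × ℝ → ℝ) (p : ℝ × ℝ) : ℝ := fderiv ℝ W p v

section Partial

variable {S : Set (ℝ × ℝ)} {W : ℝ × ℝ → ℝ} {p : ℝ × ℝ}

lemma contDiffOn_dirDeriv {m n : WithTop ℕ∞} (hS : IsOpen S) (hW : ContDiffOn ℝ n W S)
    (hmn : m + 1 ≤ n) (v : ℝ × ℝ) : ContDiffOn ℝ m (dirDeriv v W) S :=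
  (hW.fderiv_of_isOpen hS hmn).clm_apply contDiffOn_const

lemma hasDerivAt_fst_slice (hW : DifferentiableAt ℝ W p) :
    HasDerivAt (fun z => W (z, p.2)) (dirDeriv (1, 0) W p) p.1 := by
  have h : HasDerivAt (fun z : ℝ => (z, p.2)) (1, 0) p.1 :=
    (hasDerivAt_id _).prodMk (hasDerivAt_const _ _)
  exact hW.hasFDerivAt.comp_hasDerivAt p.1 h

lemma hasDerivAt_snd_slice (hW : DifferentiableAt ℝ W p) :
    HasDerivAt (fun τ => W (p.1, τ)) (dirDeriv (0, 1) W p) p.2 := by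
  have h : HasDerivAt (fun τ : ℝ => (p.1, τ)) (0, 1) p.2 :=
    (hasDerivAt_const _ _).prodMk (hasDerivAt_id _)
  exact hW.hasFDerivAt.comp_hasDerivAt p.2 h

lemma iteratedDeriv_two_fst_slice (hS : IsOpen S) (hW : ContDiffOn ℝ 2 W S) (hp : p ∈ S) :
    iteratedDeriv 2 (fun z => W (z, p.2)) p.1 = dirDeriv (1, 0) (dirDeriv (1, 0) W) p := by
  rw [iteratedDeriv_succ, iteratedDeriv_one]
  have hev : ∀ᶠ z in nhds p.1, deriv (fun z => W (z, p.2)) z = dirDeriv (1, 0) W (z, p.2) := by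
    have : ∀ᶠ z in nhds p.1, (z, p.2) ∈ S :=
      (Continuous.continuousAt (f := fun z : ℝ => (z, p.2)) (by fun_prop)).eventually
        (hS.mem_nhds hp)
    exact this.mono fun z hz => (hasDerivAt_fst_slice (p := (z, p.2))
      ((hW.differentiableOn two_ne_zero).differentiableAt (hS.mem_nhds hz))).deriv
  rw [Filter.EventuallyEq.deriv_eq hev]
  exact (hasDerivAt_fst_slice (((contDiffOn_dirDeriv hS hW (m := 1) one_add_one_eq_two.le
    _).differentiableOn one_ne_zero).differentiableAt (hS.mem_nhds hp))).deriv

lemma iteratedDeriv_two_snd_slice (hS : IsOpen S) (hW : ContDiffOn ℝ 2 W S) (hp : p ∈ S) :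
    iteratedDeriv 2 (fun τ => W (p.1, τ)) p.2 = dirDeriv (0, 1) (dirDeriv (0, 1) W) p := by
  rw [iteratedDeriv_succ, iteratedDeriv_one]
  have hev : ∀ᶠ τ in nhds p.2, deriv (fun τ => W (p.1, τ)) τ = dirDeriv (0, 1) W (p.1, τ) := by
    have : ∀ᶠ τ in nhds p.2, (p.1, τ) ∈ S :=
      (Continuous.continuousAt (f := fun τ : ℝ => (p.1, τ)) (by fun_prop)).eventually
        (hS.mem_nhds hp)
    exact this.mono fun τ hτ => (hasDerivAt_snd_slice (p := (p.1, τ))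
      ((hW.differentiableOn two_ne_zero).differentiableAt (hS.mem_nhds hτ))).deriv
  rw [Filter.EventuallyEq.deriv_eq hev]
  exact (hasDerivAt_snd_slice (((contDiffOn_dirDeriv hS hW (m := 1) one_add_one_eq_two.le
    _).differentiableOn one_ne_zero).differentiableAt (hS.mem_nhds hp))).deriv

lemma dirDeriv_mul {V : ℝ × ℝ → ℝ} (hW : DifferentiableAt ℝ W p) (hV : DifferentiableAt ℝ V p)
    (v : ℝ × ℝ) :
    dirDeriv v (fun q => W q * V q) p = W p * dirDeriv v V p + dirDeriv v W p * V p := by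
  simp only [dirDeriv]
  rw [fderiv_fun_mul hW hV]
  simp [mul_comm]

lemma dirDeriv_sub {V : ℝ × ℝ → ℝ} (hW : DifferentiableAt ℝ W p) (hV : DifferentiableAt ℝ V p)
    (v : ℝ × ℝ) :
    dirDeriv v (fun q => W q - V q) p = dirDeriv v W p - dirDeriv v V p := by
  simp only [dirDeriv]
  rw [fderiv_fun_sub hW hV]
  simp

lemma tsupport_dirDeriv_subset (v : ℝ × ℝ) (W : ℝ × ℝ → ℝ) :
    tsupport (dirDeriv v W) ⊆ tsupport W := tsupport_fderiv_apply_subset ℝ v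

end Partial

lemma integrable_of_continuousOn_of_compact {Z : ℝ × ℝ → ℝ} {S K : Set (ℝ × ℝ)} (hS : IsOpen S)
    (hK : IsCompact K) (hKS : K ⊆ S) (hZ : ContinuousOn Z S) (h0 : ∀ p ∉ K, Z p = 0) :
    Integrable Z := by
  have hsub : tsupport Z ⊆ K :=
    closure_minimal (fun p hp => by_contra fun h => hp (h0 p h)) hK.isClosed
  have hc : Continuous Z := hZ.continuous_of_tsupport_subset hS (hsub.trans hKS)
  exact hc.integrable_of_hasCompactSupport (hK.of_isClosed_subset (isClosed_tsupport Z) hsub)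

section Divergence

variable {Q : ℝ × ℝ → ℝ}

lemma integrable_dirDeriv (hQ : ContDiff ℝ 1 Q) (hc : HasCompactSupport Q) (v : ℝ × ℝ) :
    Integrable (dirDeriv v Q) :=
  ((hQ.continuous_fderiv one_ne_zero).clm_apply continuous_const).integrable_of_hasCompactSupport
    (hc.of_isClosed_subset (isClosed_tsupport _) (tsupport_dirDeriv_subset v Q))

lemma setIntegral_dirDeriv_snd (hQ : ContDiff ℝ 1 Q) (hc : HasCompactSupport Q) :
    ∫ p in Ioi (0 : ℝ) ×ˢ Ioi (0 : ℝ), dirDeriv (0, 1) Q p = -∫ y in Ioi (0 : ℝ), Q (y, 0) := by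
  rw [Measure.volume_eq_prod, setIntegral_prod _ (integrable_dirDeriv hQ hc _).integrableOn,
    ← integral_neg]
  refine setIntegral_congr_fun measurableSet_Ioi fun y _ => ?_
  have hcl : Topology.IsClosedEmbedding fun τ : ℝ => (y, τ) :=
    (Isometry.of_dist_eq fun a b => by simp [Prod.dist_eq]).isClosedEmbedding
  have hd : Continuous (dirDeriv (0, 1) Q) :=
    (hQ.continuous_fderiv one_ne_zero).clm_apply continuous_const
  have hint : Integrable fun τ => dirDeriv (0, 1) Q (y, τ) :=
    (hd.comp hcl.continuous).integrable_of_hasCompactSupport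
      (HasCompactSupport.comp_isClosedEmbedding
        (hc.of_isClosed_subset (isClosed_tsupport _) (tsupport_dirDeriv_subset _ Q)) hcl)
  have hlim : Filter.Tendsto (fun τ => Q (y, τ)) Filter.atTop (nhds 0) :=
    (hc.comp_isClosedEmbedding hcl).is_zero_at_infty.mono_left atTop_le_cocompact
  have := integral_Ioi_of_hasDerivAt_of_tendsto (a := 0) (m := 0)
    (f := fun τ => Q (y, τ)) (f' := fun τ => dirDeriv (0, 1) Q (y, τ))
    (hQ.continuous.comp hcl.continuous).continuousWithinAt
    (fun τ _ => hasDerivAt_snd_slice (p := (y, τ)) (hQ.differentiable one_ne_zero _))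
    hint.integrableOn hlim
  simpa using this

lemma setIntegral_dirDeriv_fst (hQ : ContDiff ℝ 1 Q) (hc : HasCompactSupport Q)
    (h0 : ∀ t, Q (0, t) = 0) :
    ∫ p in Ioi (0 : ℝ) ×ˢ Ioi (0 : ℝ), dirDeriv (1, 0) Q p = 0 := by
  rw [Measure.volume_eq_prod, ← Measure.prod_restrict, integral_prod_symm _ (by
    rw [Measure.prod_restrict]; exact (integrable_dirDeriv hQ hc _).integrableOn)]
  refine integral_eq_zero_of_ae (Filter.Eventually.of_forall fun t => ?_)
  have hcl : Topology.IsClosedEmbedding fun z : ℝ => (z, t) :=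
    (Isometry.of_dist_eq fun a b => by simp [Prod.dist_eq]).isClosedEmbedding
  have hd : Continuous (dirDeriv (1, 0) Q) :=
    (hQ.continuous_fderiv one_ne_zero).clm_apply continuous_const
  have hint : Integrable fun z => dirDeriv (1, 0) Q (z, t) :=
    (hd.comp hcl.continuous).integrable_of_hasCompactSupport
      (HasCompactSupport.comp_isClosedEmbedding
        (hc.of_isClosed_subset (isClosed_tsupport _) (tsupport_dirDeriv_subset _ Q)) hcl)
  have hlim : Filter.Tendsto (fun z => Q (z, t)) Filter.atTop (nhds 0) :=
    (hc.comp_isClosedEmbedding hcl).is_zero_at_infty.mono_left atTop_le_cocompact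
  have := integral_Ioi_of_hasDerivAt_of_tendsto (a := 0) (m := 0)
    (f := fun z => Q (z, t)) (f' := fun z => dirDeriv (1, 0) Q (z, t))
    (hQ.continuous.comp hcl.continuous).continuousWithinAt
    (fun z _ => hasDerivAt_fst_slice (p := (z, t)) (hQ.differentiable one_ne_zero _))
    hint.integrableOn hlim
  simpa [h0] using this

end Divergence

lemma isOpen_halfPlane : IsOpen (Ioi (0 : ℝ) ×ˢ (univ : Set ℝ)) := isOpen_Ioi.prod isOpen_univ

lemma waveOperator_eq {u : ℝ → ℝ → ℝ}
    (hu : ContDiffOn ℝ 2 (fun p : ℝ × ℝ => u p.1 p.2) (Ioi 0 ×ˢ univ)) {p : ℝ × ℝ}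
    (hp : p ∈ Ioi (0 : ℝ) ×ˢ (univ : Set ℝ)) :
    waveOperator u p.1 p.2 = dirDeriv (0, 1) (dirDeriv (0, 1) fun p => u p.1 p.2) p -
      (p.1 ^ 2 * dirDeriv (1, 0) (dirDeriv (1, 0) fun p => u p.1 p.2) p +
        p.1 * dirDeriv (1, 0) (fun p => u p.1 p.2) p + p.1 ^ 2 * u p.1 p.2) := by
  have hS := isOpen_halfPlane
  rw [← iteratedDeriv_two_fst_slice hS hu hp, ← iteratedDeriv_two_snd_slice hS hu hp,
    ← (hasDerivAt_fst_slice ((hu.differentiableOn two_ne_zero).differentiableAt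
      (hS.mem_nhds hp))).deriv]
  rfl

lemma waveAdjoint_eq {η : ℝ → ℝ → ℝ} (hη : ContDiff ℝ 2 fun p : ℝ × ℝ => η p.1 p.2)
    (p : ℝ × ℝ) :
    waveAdjoint η p.1 p.2 = dirDeriv (0, 1) (dirDeriv (0, 1) fun p => η p.1 p.2) p -
      (dirDeriv (1, 0) (dirDeriv (1, 0) fun p => p.1 ^ 2 * η p.1 p.2) p -
        dirDeriv (1, 0) (fun p => p.1 * η p.1 p.2) p + p.1 ^ 2 * η p.1 p.2) := by
  have h2 : ContDiff ℝ 2 fun p : ℝ × ℝ => p.1 ^ 2 * η p.1 p.2 := (contDiff_fst.pow 2).mul hη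
  have h1 : ContDiff ℝ 2 fun p : ℝ × ℝ => p.1 * η p.1 p.2 := contDiff_fst.mul hη
  rw [← iteratedDeriv_two_fst_slice isOpen_univ h2.contDiffOn (mem_univ p),
    ← iteratedDeriv_two_snd_slice isOpen_univ hη.contDiffOn (mem_univ p),
    ← (hasDerivAt_fst_slice (h1.differentiable two_ne_zero p)).deriv]
  rfl

lemma continuousOn_waveOperator {u : ℝ → ℝ → ℝ}
    (hu : ContDiffOn ℝ 2 (fun p : ℝ × ℝ => u p.1 p.2) (Ioi 0 ×ˢ univ)) :
    ContinuousOn (fun p : ℝ × ℝ => waveOperator u p.1 p.2) (Ioi 0 ×ˢ univ) := by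
  have hS := isOpen_halfPlane
  have h1 := fun v => contDiffOn_dirDeriv hS hu one_add_one_eq_two.le v
  have h3 := (contDiffOn_dirDeriv hS (h1 (0, 1)) (zero_add 1).le (0, 1)).continuousOn
  have h4 := (contDiffOn_dirDeriv hS (h1 (1, 0)) (zero_add 1).le (1, 0)).continuousOn
  have h5 := (h1 (1, 0)).continuousOn
  refine ContinuousOn.congr (h3.sub ((((Continuous.continuousOn (by fun_prop)).mul h4).add
    (continuousOn_fst.mul h5)).add ((Continuous.continuousOn (by fun_prop)).mul hu.continuousOn)))
    fun p hp => waveOperator_eq hu hp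

section TestFunction

variable {η : ℝ → ℝ → ℝ}

lemma continuous_waveAdjoint (hη : ContDiff ℝ 2 fun p : ℝ × ℝ => η p.1 p.2) :
    Continuous fun p : ℝ × ℝ => waveAdjoint η p.1 p.2 := by
  have hS : IsOpen (univ : Set (ℝ × ℝ)) := isOpen_univ
  have h2 : ContDiff ℝ 2 fun p : ℝ × ℝ => p.1 ^ 2 * η p.1 p.2 := (contDiff_fst.pow 2).mul hη
  have h1 : ContDiff ℝ 2 fun p : ℝ × ℝ => p.1 * η p.1 p.2 := contDiff_fst.mul hη
  have key : ∀ (v : ℝ × ℝ) {W : ℝ × ℝ → ℝ}, ContDiff ℝ 2 W →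
      ContDiffOn ℝ 1 (dirDeriv v W) univ := fun v W hW =>
    contDiffOn_dirDeriv hS hW.contDiffOn one_add_one_eq_two.le v
  have h3 := (contDiffOn_dirDeriv hS (key (0, 1) hη) (zero_add 1).le (0, 1)).continuousOn
  have h4 := (contDiffOn_dirDeriv hS (key (1, 0) h2) (zero_add 1).le (1, 0)).continuousOn
  have h5 := (key (1, 0) h1).continuousOn
  rw [← continuousOn_univ]
  exact ContinuousOn.congr (h3.sub ((h4.sub h5).add h2.continuous.continuousOn))
    fun p _ => waveAdjoint_eq hη p

lemma waveAdjoint_eq_zero (hη : ContDiff ℝ 2 fun p : ℝ × ℝ => η p.1 p.2) {p : ℝ × ℝ}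
    (hp : p ∉ tsupport fun p : ℝ × ℝ => η p.1 p.2) : waveAdjoint η p.1 p.2 = 0 := by
  have hsub2 : tsupport (fun p : ℝ × ℝ => p.1 ^ 2 * η p.1 p.2) ⊆
      tsupport fun p : ℝ × ℝ => η p.1 p.2 := tsupport_mul_subset_right
  have hsub1 : tsupport (fun p : ℝ × ℝ => p.1 * η p.1 p.2) ⊆
      tsupport fun p : ℝ × ℝ => η p.1 p.2 := tsupport_mul_subset_right
  have h0 : η p.1 p.2 = 0 :=
    image_eq_zero_of_notMem_tsupport (f := fun p : ℝ × ℝ => η p.1 p.2) hp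
  have hz : ∀ {W : ℝ × ℝ → ℝ}, (tsupport W ⊆ tsupport fun p : ℝ × ℝ => η p.1 p.2) → W p = 0 :=
    fun hW => image_eq_zero_of_notMem_tsupport fun h => hp (hW h)
  rw [waveAdjoint_eq hη, h0,
    hz ((tsupport_dirDeriv_subset _ _).trans (tsupport_dirDeriv_subset _ _)),
    hz (((tsupport_dirDeriv_subset _ _).trans (tsupport_dirDeriv_subset _ _)).trans hsub2),
    hz ((tsupport_dirDeriv_subset _ _).trans hsub1)]
  ring

/-- Green's formula for `waveOperator` on the quarter plane: the difference of the two integrands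
is the divergence of `(-(u (y² η)_y - u_y y² η - u y η), u η_t - u_t η)`. -/
lemma setIntegral_mul_waveAdjoint {u : ℝ → ℝ → ℝ}
    (hu : ContDiffOn ℝ 2 (fun p : ℝ × ℝ => u p.1 p.2) (Ioi 0 ×ˢ univ))
    (hη : ContDiff ℝ 2 fun p : ℝ × ℝ => η p.1 p.2)
    (hc : HasCompactSupport fun p : ℝ × ℝ => η p.1 p.2)
    (hs : tsupport (fun p : ℝ × ℝ => η p.1 p.2) ⊆ Ioi 0 ×ˢ univ) :
    ∫ p in Ioi (0 : ℝ) ×ˢ Ioi (0 : ℝ), u p.1 p.2 * waveAdjoint η p.1 p.2 =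
      (∫ p in Ioi (0 : ℝ) ×ˢ Ioi (0 : ℝ), waveOperator u p.1 p.2 * η p.1 p.2) -
      ∫ y in Ioi (0 : ℝ), (u y 0 * deriv (fun τ => η y τ) 0 -
        deriv (fun τ => u y τ) 0 * η y 0) := by
  have hS := isOpen_halfPlane
  set S : Set (ℝ × ℝ) := Ioi 0 ×ˢ univ
  set W : ℝ × ℝ → ℝ := fun p => u p.1 p.2 with hW
  set E : ℝ × ℝ → ℝ := fun p => η p.1 p.2 with hE
  set M₁ : ℝ × ℝ → ℝ := fun p => p.1 * E p with hM₁
  set M₂ : ℝ × ℝ → ℝ := fun p => p.1 ^ 2 * E p with hM₂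
  have hcM₁ : ContDiff ℝ 2 M₁ := contDiff_fst.mul hη
  have hcM₂ : ContDiff ℝ 2 M₂ := (contDiff_fst.pow 2).mul hη
  have hd : ∀ (v : ℝ × ℝ) {V : ℝ × ℝ → ℝ}, ContDiffOn ℝ 2 V S → ContDiffOn ℝ 1 (dirDeriv v V) S :=
    fun v V hV => contDiffOn_dirDeriv hS hV one_add_one_eq_two.le v
  have hz : ∀ {V : ℝ × ℝ → ℝ}, tsupport V ⊆ tsupport E → ∀ p ∉ tsupport E, V p = 0 :=
    fun hV p hp => image_eq_zero_of_notMem_tsupport fun h => hp (hV h)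
  have hzE := hz (V := E) subset_rfl
  have hzM₁ := hz (V := M₁) tsupport_mul_subset_right
  have hzM₂ := hz (V := M₂) tsupport_mul_subset_right
  have hzE' := hz (V := dirDeriv (0, 1) E) (tsupport_dirDeriv_subset _ _)
  have hzM₂' := hz (V := dirDeriv (1, 0) M₂)
    ((tsupport_dirDeriv_subset _ _).trans tsupport_mul_subset_right)
  set Q₁ : ℝ × ℝ → ℝ := fun p => W p * dirDeriv (0, 1) E p - dirDeriv (0, 1) W p * E p with hQ₁
  set Q₂ : ℝ × ℝ → ℝ := fun p =>
    W p * dirDeriv (1, 0) M₂ p - dirDeriv (1, 0) W p * M₂ p - W p * M₁ p with hQ₂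
  have hW1 : ContDiffOn ℝ 1 W S := hu.of_le one_le_two
  have hQ₁c : ContDiffOn ℝ 1 Q₁ S := (hW1.mul (hd _ hη.contDiffOn)).sub
    ((hd _ hu).mul (hη.of_le one_le_two).contDiffOn)
  have hQ₂c : ContDiffOn ℝ 1 Q₂ S := ((hW1.mul (hd _ hcM₂.contDiffOn)).sub
    ((hd _ hu).mul (hcM₂.of_le one_le_two).contDiffOn)).sub
    (hW1.mul (hcM₁.of_le one_le_two).contDiffOn)
  have hext : ∀ {Q : ℝ × ℝ → ℝ}, ContDiffOn ℝ 1 Q S → (∀ p ∉ tsupport E, Q p = 0) →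
      ContDiff ℝ 1 Q ∧ HasCompactSupport Q := fun {Q} hQ h0 => by
    have hsub : tsupport Q ⊆ tsupport E :=
      closure_minimal (fun p hp => by_contra fun h => hp (h0 p h)) (isClosed_tsupport E)
    refine ⟨contDiff_iff_contDiffAt.2 fun p => ?_,
      hc.of_isClosed_subset (isClosed_tsupport Q) hsub⟩
    by_cases hp : p ∈ tsupport Q
    · exact hQ.contDiffAt (hS.mem_nhds (hs (hsub hp)))
    · exact contDiffAt_const.congr_of_eventuallyEq (notMem_tsupport_iff_eventuallyEq.1 hp)
  obtain ⟨hQ₁d, hQ₁s⟩ := hext hQ₁c fun p hp => by simp only [hQ₁, hzE p hp, hzE' p hp]; ring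
  obtain ⟨hQ₂d, hQ₂s⟩ := hext hQ₂c fun p hp => by
    simp only [hQ₂, hzM₁ p hp, hzM₂ p hp, hzM₂' p hp]; ring
  have hI1 : Integrable fun p : ℝ × ℝ => W p * waveAdjoint η p.1 p.2 :=
    integrable_of_continuousOn_of_compact hS hc hs
      (hu.continuousOn.mul (continuous_waveAdjoint hη).continuousOn)
      fun p hp => by rw [waveAdjoint_eq_zero hη hp, mul_zero]
  have hI2 : Integrable fun p : ℝ × ℝ => waveOperator u p.1 p.2 * E p :=
    integrable_of_continuousOn_of_compact hS hc hs
      ((continuousOn_waveOperator hu).mul hη.continuous.continuousOn)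
      fun p hp => by rw [hzE p hp, mul_zero]
  have hpt : ∀ p ∈ Ioi (0 : ℝ) ×ˢ Ioi (0 : ℝ),
      W p * waveAdjoint η p.1 p.2 - waveOperator u p.1 p.2 * E p =
        dirDeriv (0, 1) Q₁ p - dirDeriv (1, 0) Q₂ p := fun p hp => by
    have hpS : p ∈ S := ⟨hp.1, mem_univ _⟩
    have hdiff : ∀ {V : ℝ × ℝ → ℝ}, ContDiffOn ℝ 1 V S → DifferentiableAt ℝ V p := fun hV =>
      (hV.differentiableOn one_ne_zero).differentiableAt (hS.mem_nhds hpS)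
    have dW := hdiff hW1
    have dE := hdiff (hη.of_le one_le_two).contDiffOn
    have dM₁ := hdiff (hcM₁.of_le one_le_two).contDiffOn
    have dM₂ := hdiff (hcM₂.of_le one_le_two).contDiffOn
    have dWy := hdiff (hd (1, 0) hu)
    have dWt := hdiff (hd (0, 1) hu)
    have dEt := hdiff (hd (0, 1) hη.contDiffOn)
    have dM₂y := hdiff (hd (1, 0) hcM₂.contDiffOn)
    rw [hQ₁, dirDeriv_sub (dW.fun_mul dEt) (dWt.fun_mul dE), dirDeriv_mul dW dEt, dirDeriv_mul dWt dE,
      hQ₂, dirDeriv_sub ((dW.fun_mul dM₂y).fun_sub (dWy.fun_mul dM₂)) (dW.fun_mul dM₁),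
      dirDeriv_sub (dW.fun_mul dM₂y) (dWy.fun_mul dM₂), dirDeriv_mul dW dM₂y, dirDeriv_mul dWy dM₂,
      dirDeriv_mul dW dM₁, waveAdjoint_eq hη, waveOperator_eq hu hpS]
    simp only [hM₁, hM₂, hW, hE]
    ring
  have hdiv : (∫ p in Ioi (0 : ℝ) ×ˢ Ioi (0 : ℝ), W p * waveAdjoint η p.1 p.2) -
      ∫ p in Ioi (0 : ℝ) ×ˢ Ioi (0 : ℝ), waveOperator u p.1 p.2 * E p =
      -∫ y in Ioi (0 : ℝ), Q₁ (y, 0) := by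
    rw [← integral_sub hI1.integrableOn hI2.integrableOn,
      setIntegral_congr_fun (measurableSet_Ioi.prod measurableSet_Ioi) hpt,
      integral_sub (integrable_dirDeriv hQ₁d hQ₁s _).integrableOn
        (integrable_dirDeriv hQ₂d hQ₂s _).integrableOn,
      setIntegral_dirDeriv_snd hQ₁d hQ₁s, setIntegral_dirDeriv_fst hQ₂d hQ₂s fun t => ?_, sub_zero]
    have h0 : ((0 : ℝ), t) ∉ tsupport E := fun h => lt_irrefl (0 : ℝ) (hs h).1
    simp only [hQ₂, hzM₁ _ h0, hzM₂ _ h0, hzM₂' _ h0]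
    ring
  have hb : ∫ y in Ioi (0 : ℝ), Q₁ (y, 0) = ∫ y in Ioi (0 : ℝ),
      (u y 0 * deriv (fun τ => η y τ) 0 - deriv (fun τ => u y τ) 0 * η y 0) := by
    refine setIntegral_congr_fun measurableSet_Ioi fun y hy => ?_
    have hyS : ((y, 0) : ℝ × ℝ) ∈ S := ⟨hy, mem_univ _⟩
    have h1 := (hasDerivAt_snd_slice (p := (y, 0)) (hη.differentiable two_ne_zero _)).deriv
    have h2 := (hasDerivAt_snd_slice (p := (y, 0))
      ((hu.differentiableOn two_ne_zero).differentiableAt (hS.mem_nhds hyS))).deriv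
    simp only [hQ₁]
    rw [← h1, ← h2]
  rw [← hb]
  linarith

end TestFunction

/-! ### The weak equation, and its pointwise form for smooth solutions -/

/-- The kernel `besselKernel y t l`, extended from `y, l > 0` to a smooth function of all real
arguments. -/
noncomputable def besselWave (l y t : ℝ) : ℝ :=
  besselEntire 0 (y ^ 2 + l * (2 * y * Real.exp t)) +
    besselEntire 0 (y ^ 2 + l * (2 * y * Real.exp (-t)))

lemma contDiff_besselWave (l : ℝ) : ContDiff ℝ 2 fun p : ℝ × ℝ => besselWave l p.1 p.2 :=
  ((contDiff_besselEntire 0 (m := 2)).comp (by fun_prop)).add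
    ((contDiff_besselEntire 0 (m := 2)).comp (by fun_prop))

lemma iteratedDeriv_two_eq {f f' : ℝ → ℝ} {f'' x : ℝ} (h : ∀ x, HasDerivAt f (f' x) x)
    (h' : HasDerivAt f' f'' x) : iteratedDeriv 2 f x = f'' := by
  rw [iteratedDeriv_succ, iteratedDeriv_one, funext fun x => (h x).deriv, h'.deriv]

lemma waveOperator_besselWave (l y t : ℝ) : waveOperator (besselWave l) y t = 0 := by
  have hz : ∀ c y : ℝ, HasDerivAt (fun y => y ^ 2 + l * (2 * y * c)) (2 * y + 2 * l * c) y :=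
    fun c y => by
      have := ((hasDerivAt_id y).pow 2).add ((((hasDerivAt_id y).const_mul 2).mul_const c).const_mul l)
      refine this.congr_deriv ?_
      simp
      ring
  have hy : ∀ (n : ℕ) (c y : ℝ), HasDerivAt (fun y => besselEntire n (y ^ 2 + l * (2 * y * c)))
      (-(besselEntire (n + 1) (y ^ 2 + l * (2 * y * c))) / 4 * (2 * y + 2 * l * c)) y :=
    fun n c y => (hasDerivAt_besselEntire n _).comp y (hz c y)
  have hy2 : ∀ c y : ℝ, HasDerivAt
      (fun y => -(besselEntire 1 (y ^ 2 + l * (2 * y * c))) / 4 * (2 * y + 2 * l * c))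
      (besselEntire 2 (y ^ 2 + l * (2 * y * c)) / 16 * (2 * y + 2 * l * c) ^ 2 -
        besselEntire 1 (y ^ 2 + l * (2 * y * c)) / 2) y := fun c y => by
    have := ((hy 1 c y).neg.div_const 4).mul
      (((hasDerivAt_id y).const_mul 2).add_const (2 * l * c))
    refine this.congr_deriv ?_
    simp
    ring
  have hexp : ∀ σ t : ℝ, HasDerivAt (fun t => Real.exp (σ * t)) (σ * Real.exp (σ * t)) t :=
    fun σ t => by
      have := ((hasDerivAt_id t).const_mul σ).exp
      refine this.congr_deriv ?_
      simp
      ring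
  have ht : ∀ (n : ℕ) (σ t : ℝ),
      HasDerivAt (fun t => besselEntire n (y ^ 2 + l * (2 * y * Real.exp (σ * t))))
      (-(besselEntire (n + 1) (y ^ 2 + l * (2 * y * Real.exp (σ * t)))) / 4 *
        (2 * l * y * (σ * Real.exp (σ * t)))) t := fun n σ t => by
    have := (hasDerivAt_besselEntire n (y ^ 2 + l * (2 * y * Real.exp (σ * t)))).comp t
      ((((hexp σ t).const_mul (2 * y)).const_mul l).const_add (y ^ 2))
    refine this.congr_deriv ?_
    ring
  have ht2 : ∀ σ t : ℝ, HasDerivAt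
      (fun t => -(besselEntire 1 (y ^ 2 + l * (2 * y * Real.exp (σ * t)))) / 4 *
        (2 * l * y * (σ * Real.exp (σ * t))))
      (besselEntire 2 (y ^ 2 + l * (2 * y * Real.exp (σ * t))) / 16 *
        (2 * l * y * (σ * Real.exp (σ * t))) ^ 2 -
        besselEntire 1 (y ^ 2 + l * (2 * y * Real.exp (σ * t))) / 4 *
          (2 * l * y * (σ ^ 2 * Real.exp (σ * t)))) t := fun σ t => by
    have := ((ht 1 σ t).neg.div_const 4).mul (((hexp σ t).const_mul σ).const_mul (2 * l * y))
    refine this.congr_deriv ?_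
    simp only [one_add_one_eq_two, Pi.neg_apply]
    ring
  have htt := iteratedDeriv_two_eq (x := t) (fun t => (ht 0 1 t).add (ht 0 (-1) t))
    ((ht2 1 t).add (ht2 (-1) t))
  have hyy := iteratedDeriv_two_eq (x := y)
    (fun y => (hy 0 (Real.exp (1 * t)) y).add (hy 0 (Real.exp (-1 * t)) y))
    ((hy2 (Real.exp (1 * t)) y).add (hy2 (Real.exp (-1 * t)) y))
  have hy1 := ((hy 0 (Real.exp (1 * t)) y).add (hy 0 (Real.exp (-1 * t)) y)).deriv
  have r1 := mul_besselEntire_two (y ^ 2 + l * (2 * y * Real.exp (1 * t)))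
  have r2 := mul_besselEntire_two (y ^ 2 + l * (2 * y * Real.exp (-1 * t)))
  have w1 : (fun τ => besselWave l y τ) =
      (fun t => besselEntire 0 (y ^ 2 + l * (2 * y * Real.exp (1 * t)))) +
        fun t => besselEntire 0 (y ^ 2 + l * (2 * y * Real.exp (-1 * t))) := by
    funext τ
    simp [besselWave]
  have w2 : (fun z => besselWave l z t) =
      (fun y => besselEntire 0 (y ^ 2 + l * (2 * y * Real.exp (1 * t)))) +
        fun y => besselEntire 0 (y ^ 2 + l * (2 * y * Real.exp (-1 * t))) := by
    funext z
    simp [besselWave]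
  have w0 : besselWave l y t = besselEntire 0 (y ^ 2 + l * (2 * y * Real.exp (1 * t))) +
      besselEntire 0 (y ^ 2 + l * (2 * y * Real.exp (-1 * t))) := congrFun w1 t
  rw [waveOperator, w1, w2, w0, htt, hyy, hy1]
  simp only [zero_add]
  linear_combination (-y ^ 2 / 4) * (r1 + r2)

lemma deriv_zero_of_even {f : ℝ → ℝ} (hf : ∀ t, f (-t) = f t) : deriv f 0 = 0 := by
  have h := deriv_comp_neg (f := f) (x := (0 : ℝ))
  rw [funext hf, neg_zero] at h
  linarith

lemma besselWave_neg (l y t : ℝ) : besselWave l y (-t) = besselWave l y t := by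
  rw [besselWave, besselWave, neg_neg, add_comm]

lemma besselSolution_neg (φ : ℝ → ℝ) (y t : ℝ) :
    besselSolution φ y (-t) = besselSolution φ y t := by
  simp only [besselSolution, besselKernel, neg_neg, add_comm]

lemma besselSolution_eq (φ : ℝ → ℝ) {y : ℝ} (hy : 0 < y) (t : ℝ) :
    besselSolution φ y t = 1 / 2 * ∫ l in Ioi (0 : ℝ), φ l * besselWave l y t := by
  rw [besselSolution]
  congr 1
  refine setIntegral_congr_fun measurableSet_Ioi fun l hl => ?_
  simp only [besselKernel_eq hy (le_of_lt hl), besselWave]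

/-- Fubini's theorem for the integral of `besselSolution φ` along a map `a` into the half plane,
against a weight supported where `besselKernel` is uniformly controlled. -/
lemma integral_besselSolution_mul {X : Type*} [TopologicalSpace X] [SecondCountableTopology X]
    [MeasurableSpace X] [BorelSpace X] {μ : Measure X}
    [SFinite μ] {φ : ℝ → ℝ} (hφ : AEStronglyMeasurable φ (volume.restrict (Ioi 0)))
    (hw : IntegrableOn (fun l => (1 + l) ^ (-(1 / 4) : ℝ) * φ l) (Ioi 0))
    {a : X → ℝ × ℝ} (ha : Continuous a) {ζ : X → ℝ} (hζ : Integrable ζ μ) {b T : ℝ} (hb : 0 < b)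
    (hsupp : ∀ x, ζ x ≠ 0 → b ≤ (a x).1 ∧ |(a x).2| ≤ T) :
    ∫ x, besselSolution φ (a x).1 (a x).2 * ζ x ∂μ =
      1 / 2 * ∫ l in Ioi (0 : ℝ), φ l * ∫ x, besselWave l (a x).1 (a x).2 * ζ x ∂μ := by
  obtain ⟨C, hC, hbd⟩ := exists_besselKernel_bound hb T
  have hcont : Continuous fun p : X × ℝ => besselWave p.2 (a p.1).1 (a p.1).2 :=
    continuous_besselEntire_kernel.comp (f := fun p : X × ℝ => (a p.1, p.2)) (by fun_prop)
  have hint : Integrable (Function.uncurry fun (x : X) (l : ℝ) =>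
      φ l * besselWave l (a x).1 (a x).2 * ζ x) (μ.prod (volume.restrict (Ioi 0))) := by
    refine ((hζ.norm.const_mul C).mul_prod hw.norm).mono' ?_ ?_
    · exact (hφ.comp_snd.mul hcont.aestronglyMeasurable).mul hζ.1.comp_fst
    · have hpos : ∀ᵐ p : X × ℝ ∂(μ.prod (volume.restrict (Ioi 0))), p.2 ∈ Ioi (0 : ℝ) :=
        Measure.quasiMeasurePreserving_snd.ae (ae_restrict_mem measurableSet_Ioi)
      refine hpos.mono fun p hp => ?_
      obtain ⟨x, l⟩ := p
      have hl : (0 : ℝ) < l := hp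
      simp only [Function.uncurry_apply_pair]
      rw [norm_mul, norm_mul, norm_mul, Real.norm_of_nonneg (Real.rpow_nonneg (by linarith) _)]
      by_cases hx : ζ x = 0
      · simp [hx]
      · obtain ⟨h1, h2⟩ := hsupp x hx
        have h3 := hbd (a x).1 (a x).2 l h1 h2 hl.le
        rw [besselKernel_eq (hb.trans_le h1) hl.le] at h3
        calc ‖φ l‖ * ‖besselWave l (a x).1 (a x).2‖ * ‖ζ x‖
            ≤ ‖φ l‖ * (C * (1 + l) ^ (-(1 / 4) : ℝ)) * ‖ζ x‖ := by gcongr; exact h3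
          _ = _ := by ring
  have h1 : ∀ x, besselSolution φ (a x).1 (a x).2 * ζ x =
      1 / 2 * ∫ l in Ioi (0 : ℝ), φ l * besselWave l (a x).1 (a x).2 * ζ x := fun x => by
    by_cases hx : ζ x = 0
    · simp [hx]
    · rw [besselSolution_eq φ (hb.trans_le (hsupp x hx).1), integral_mul_const, mul_assoc]
  simp only [h1]
  rw [integral_const_mul, integral_integral_swap hint]
  simp only [mul_assoc, integral_const_mul]

lemma exists_box_of_isCompact {K : Set (ℝ × ℝ)} (hK : IsCompact K) (hKS : K ⊆ Ioi 0 ×ˢ univ) :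
    ∃ b > 0, ∃ T : ℝ, ∀ p ∈ K, b ≤ p.1 ∧ |p.2| ≤ T := by
  obtain ⟨T, hT⟩ := hK.exists_bound_of_continuousOn (f := fun p : ℝ × ℝ => p.2) (by fun_prop)
  rcases K.eq_empty_or_nonempty with rfl | hne
  · exact ⟨1, one_pos, 0, by simp⟩
  · obtain ⟨q, hq, hmin⟩ := hK.exists_isMinOn hne (f := fun p : ℝ × ℝ => p.1) (by fun_prop)
    exact ⟨q.1, (hKS hq).1, T, fun p hp => ⟨hmin hp, hT p hp⟩⟩

/-- The weak equation holds for each `besselWave l` by Green's formula, and passes to the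
superposition by Fubini's theorem. -/
lemma besselSolution_weak_equation {φ : ℝ → ℝ}
    (hφ : AEStronglyMeasurable φ (volume.restrict (Ioi 0)))
    (hw : IntegrableOn (fun l => (1 + l) ^ (-(1 / 4) : ℝ) * φ l) (Ioi 0)) {η : ℝ → ℝ → ℝ}
    (hη : ContDiff ℝ 2 fun p : ℝ × ℝ => η p.1 p.2)
    (hc : HasCompactSupport fun p : ℝ × ℝ => η p.1 p.2)
    (hs : tsupport (fun p : ℝ × ℝ => η p.1 p.2) ⊆ Ioi 0 ×ˢ univ) :
    ∫ p in Ioi (0 : ℝ) ×ˢ Ioi (0 : ℝ), besselSolution φ p.1 p.2 * waveAdjoint η p.1 p.2 =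
      -∫ y in Ioi (0 : ℝ), besselSolution φ y 0 * deriv (fun τ => η y τ) 0 := by
  set E : ℝ × ℝ → ℝ := fun p => η p.1 p.2
  obtain ⟨b, hb, T, hbox⟩ := exists_box_of_isCompact hc hs
  have hdE : ∀ y : ℝ, deriv (fun τ => η y τ) 0 = dirDeriv (0, 1) E (y, 0) := fun y =>
    (hasDerivAt_snd_slice (p := (y, 0)) (hη.differentiable two_ne_zero _)).deriv
  have hcl : Topology.IsClosedEmbedding fun z : ℝ => (z, (0 : ℝ)) :=
    (Isometry.of_dist_eq fun a b => by simp [Prod.dist_eq]).isClosedEmbedding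
  have hd : Continuous (dirDeriv (0, 1) E) :=
    (hη.continuous_fderiv two_ne_zero).clm_apply continuous_const
  have hint0 : Integrable fun y => deriv (fun τ => η y τ) 0 := by
    simp only [hdE]
    exact (hd.comp hcl.continuous).integrable_of_hasCompactSupport
      (HasCompactSupport.comp_isClosedEmbedding
        (hc.of_isClosed_subset (isClosed_tsupport _) (tsupport_dirDeriv_subset _ E)) hcl)
  have hint1 : Integrable fun p : ℝ × ℝ => waveAdjoint η p.1 p.2 :=
    integrable_of_continuousOn_of_compact isOpen_halfPlane hc hs
      (continuous_waveAdjoint hη).continuousOn fun p hp => waveAdjoint_eq_zero hη hp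
  have h1 := integral_besselSolution_mul hφ hw (μ := volume.restrict (Ioi 0 ×ˢ Ioi 0))
    (a := fun p => p) continuous_id hint1.integrableOn hb (T := T)
    fun p hp => hbox p (by_contra fun h => hp (waveAdjoint_eq_zero hη h))
  have h2 := integral_besselSolution_mul hφ hw (μ := volume.restrict (Ioi 0))
    (a := fun y : ℝ => (y, (0 : ℝ))) (by fun_prop) hint0.integrableOn hb (T := T) fun y hy => by
      rw [hdE] at hy
      exact hbox (y, 0) (by_contra fun h => hy (image_eq_zero_of_notMem_tsupport fun h' =>
        h (tsupport_dirDeriv_subset _ E h')))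
  rw [h1, h2, ← mul_neg, ← integral_neg]
  congr 1
  refine integral_congr_ae (Filter.Eventually.of_forall fun l => ?_)
  have h := setIntegral_mul_waveAdjoint (contDiff_besselWave l).contDiffOn hη hc hs
  have h0 : ∀ y, deriv (fun τ => besselWave l y τ) 0 = 0 := fun y =>
    deriv_zero_of_even (besselWave_neg l y)
  simp only [waveOperator_besselWave, zero_mul, integral_zero, h0, sub_zero, zero_sub] at h
  simp only
  rw [h, mul_neg]

/-- A twice continuously differentiable function that is even in `t` and satisfies the weak
equation solves the equation pointwise. -/
lemma waveOperator_eq_zero_of_weak {u : ℝ → ℝ → ℝ}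
    (hu : ContDiffOn ℝ 2 (fun p : ℝ × ℝ => u p.1 p.2) (Ioi 0 ×ˢ univ))
    (heven : ∀ y t, u y (-t) = u y t)
    (hweak : ∀ η : ℝ → ℝ → ℝ, ContDiff ℝ 2 (fun p : ℝ × ℝ => η p.1 p.2) →
      HasCompactSupport (fun p : ℝ × ℝ => η p.1 p.2) →
      tsupport (fun p : ℝ × ℝ => η p.1 p.2) ⊆ Ioi 0 ×ˢ univ →
      ∫ p in Ioi (0 : ℝ) ×ˢ Ioi (0 : ℝ), u p.1 p.2 * waveAdjoint η p.1 p.2 =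
        -∫ y in Ioi (0 : ℝ), u y 0 * deriv (fun τ => η y τ) 0) {y : ℝ} (hy : 0 < y) (t : ℝ) :
    waveOperator u y t = 0 := by
  have hL := continuousOn_waveOperator hu
  have hQ : IsOpen (Ioi (0 : ℝ) ×ˢ Ioi (0 : ℝ)) := isOpen_Ioi.prod isOpen_Ioi
  have hsub : Ioi (0 : ℝ) ×ˢ Ioi (0 : ℝ) ⊆ Ioi 0 ×ˢ univ := prod_mono subset_rfl (subset_univ _)
  have hae : ∀ᵐ p : ℝ × ℝ, p ∈ Ioi (0 : ℝ) ×ˢ Ioi (0 : ℝ) → waveOperator u p.1 p.2 = 0 := by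
    refine hQ.ae_eq_zero_of_integral_contDiff_smul_eq_zero
      ((hL.mono hsub).locallyIntegrableOn hQ.measurableSet) fun g hg hgc hgs => ?_
    have hg2 : ContDiff ℝ 2 g := contDiff_infty.1 hg 2
    have h1 := hweak (fun y t => g (y, t)) hg2 hgc (hgs.trans hsub)
    rw [setIntegral_mul_waveAdjoint hu hg2 hgc (hgs.trans hsub)] at h1
    have h2 : ∀ y, g (y, 0) = 0 := fun y =>
      image_eq_zero_of_notMem_tsupport fun h => lt_irrefl (0 : ℝ) (hgs h).2
    simp only [h2, mul_zero, sub_zero] at h1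
    rw [← setIntegral_eq_integral_of_forall_compl_eq_zero (s := Ioi (0 : ℝ) ×ˢ Ioi (0 : ℝ))
      fun p hp => by rw [image_eq_zero_of_notMem_tsupport fun h => hp (hgs h), zero_smul]]
    simp only [smul_eq_mul, mul_comm (g _)]
    linarith
  have hpos : ∀ y > 0, ∀ t > 0, waveOperator u y t = 0 := fun y hy t ht =>
    Measure.eqOn_open_of_ae_eq (f := fun p : ℝ × ℝ => waveOperator u p.1 p.2)
      (g := fun _ => (0 : ℝ)) (μ := volume) ((ae_restrict_iff' hQ.measurableSet).2 hae) hQ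
      (hL.mono hsub) continuousOn_const (x := (y, t)) ⟨hy, ht⟩
  rcases lt_trichotomy t 0 with ht | rfl | ht
  · have h := hpos y hy (-t) (neg_pos.2 ht)
    have h1 : iteratedDeriv 2 (fun τ => u y τ) (-t) = iteratedDeriv 2 (fun τ => u y τ) t := by
      have := iteratedDeriv_comp_neg 2 (fun τ => u y τ) (-t)
      simp only [heven, neg_neg] at this
      simpa using this
    simp only [waveOperator, heven, h1] at h
    exact h
  · have hca : ContinuousAt (fun t => waveOperator u y t) 0 :=
      ContinuousAt.comp (f := fun t : ℝ => (y, t)) (x := 0)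
        (hL.continuousAt (isOpen_halfPlane.mem_nhds ⟨hy, mem_univ _⟩)) (by fun_prop)
    refine tendsto_nhds_unique (hca.tendsto.mono_left (nhdsWithin_le_nhds (s := Ioi 0))) ?_
    refine tendsto_const_nhds.congr' ?_
    filter_upwards [self_mem_nhdsWithin] with t ht
    exact (hpos y hy t ht).symm
  · exact hpos y hy t ht

/-! ### Regularity under the moment condition -/

/-- The superposition `∫ ψ(l) h(A + l B) dl` of profiles `h`, as a function of `(A, B)`. -/
noncomputable def profileIntegral (h ψ : ℝ → ℝ) (p : ℝ × ℝ) : ℝ :=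
  ∫ l in Ioi (0 : ℝ), ψ l * h (p.1 + l * p.2)

section Profile

variable {h h' ψ : ℝ → ℝ} {C C' α β : ℝ}

lemma norm_mul_profile_le (hβ : 0 ≤ β) (hb : ∀ z, 0 ≤ z → |h z| ≤ C * (1 + z) ^ (-β)) {m : ℝ}
    (hm : 0 < m) (hm1 : m ≤ 1) {p : ℝ × ℝ} (hp : 0 ≤ p.1) (hp2 : m ≤ p.2) {l : ℝ} (hl : 0 ≤ l) :
    ‖ψ l * h (p.1 + l * p.2)‖ ≤ C * m ^ (-β) * ‖(1 + l) ^ (-β) * ψ l‖ := by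
  have hC : 0 ≤ C := by simpa using (abs_nonneg _).trans (hb 0 le_rfl)
  have hp0 : 0 ≤ p.2 := hm.le.trans hp2
  rw [norm_mul, norm_mul, Real.norm_of_nonneg (Real.rpow_nonneg (by linarith) _)]
  calc ‖ψ l‖ * ‖h (p.1 + l * p.2)‖ ≤ ‖ψ l‖ * (C * (m ^ (-β) * (1 + l) ^ (-β))) := by
        gcongr
        refine (hb _ (by positivity)).trans ?_
        gcongr
        exact rpow_neg_one_add_path_le hβ hm hm1 hp2 hl hp
    _ = _ := by ring

lemma aestronglyMeasurable_mul_profile (hh : Continuous h)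
    (hψ : AEStronglyMeasurable ψ (volume.restrict (Ioi 0))) (p : ℝ × ℝ) :
    AEStronglyMeasurable (fun l => ψ l * h (p.1 + l * p.2)) (volume.restrict (Ioi 0)) :=
  hψ.mul (hh.comp (by fun_prop)).aestronglyMeasurable

lemma integrableOn_mul_profile (hh : Continuous h)
    (hψ : AEStronglyMeasurable ψ (volume.restrict (Ioi 0))) (hβ : 0 ≤ β)
    (hb : ∀ z, 0 ≤ z → |h z| ≤ C * (1 + z) ^ (-β))
    (hi : IntegrableOn (fun l => (1 + l) ^ (-β) * ψ l) (Ioi 0)) {p : ℝ × ℝ}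
    (hp : p ∈ Ioi (0 : ℝ) ×ˢ Ioi (0 : ℝ)) :
    IntegrableOn (fun l => ψ l * h (p.1 + l * p.2)) (Ioi 0) :=
  (hi.norm.const_mul _).mono' (aestronglyMeasurable_mul_profile hh hψ p)
    ((ae_restrict_mem measurableSet_Ioi).mono fun _ hl => norm_mul_profile_le hβ hb
      (lt_min one_pos hp.2) (min_le_left _ _) (le_of_lt hp.1) (min_le_right _ _) (le_of_lt hl))

lemma eventually_nonneg_and_min_le {p : ℝ × ℝ} (hp : p ∈ Ioi (0 : ℝ) ×ˢ Ioi (0 : ℝ)) :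
    ∀ᶠ q : ℝ × ℝ in nhds p, 0 ≤ q.1 ∧ min 1 (p.2 / 2) ≤ q.2 :=
  (continuous_fst.continuousAt.eventually (lt_mem_nhds hp.1)).and
    (continuous_snd.continuousAt.eventually (lt_mem_nhds (half_lt_self hp.2))) |>.mono
    fun _ h => ⟨h.1.le, (min_le_right _ _).trans h.2.le⟩

lemma continuousOn_profileIntegral (hh : Continuous h)
    (hψ : AEStronglyMeasurable ψ (volume.restrict (Ioi 0))) (hβ : 0 ≤ β)
    (hb : ∀ z, 0 ≤ z → |h z| ≤ C * (1 + z) ^ (-β))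
    (hi : IntegrableOn (fun l => (1 + l) ^ (-β) * ψ l) (Ioi 0)) :
    ContinuousOn (profileIntegral h ψ) (Ioi 0 ×ˢ Ioi 0) := fun p hp => by
  have hm : 0 < min 1 (p.2 / 2) := lt_min one_pos (half_pos hp.2)
  refine (continuousAt_of_dominated (F := fun (p : ℝ × ℝ) l => ψ l * h (p.1 + l * p.2))
    (Filter.Eventually.of_forall fun q => aestronglyMeasurable_mul_profile hh hψ q)
    ((eventually_nonneg_and_min_le hp).mono fun q hq => (ae_restrict_mem measurableSet_Ioi).mono fun l hl =>
      norm_mul_profile_le hβ hb hm (min_le_left _ _) hq.1 hq.2 (le_of_lt hl))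
    (hi.norm.const_mul _) (Filter.Eventually.of_forall fun l => ?_)).continuousWithinAt
  exact (continuous_const.mul (hh.comp (by fun_prop))).continuousAt

/-- Each derivative of the profile costs at most one power of `l`. -/
lemma hasFDerivAt_profileIntegral (hd : ∀ z, HasDerivAt h (h' z) z) (hh' : Continuous h')
    (hψ : AEStronglyMeasurable ψ (volume.restrict (Ioi 0))) (hβ : 0 ≤ β) (hα : 0 ≤ α)
    (hb : ∀ z, 0 ≤ z → |h z| ≤ C * (1 + z) ^ (-β))
    (hb' : ∀ z, 0 ≤ z → |h' z| ≤ C' * (1 + z) ^ (-α))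
    (hi : IntegrableOn (fun l => (1 + l) ^ (-β) * ψ l) (Ioi 0))
    (hi' : IntegrableOn (fun l => (1 + l) ^ (-α) * ψ l) (Ioi 0))
    (hi'' : IntegrableOn (fun l => (1 + l) ^ (-α) * (l * ψ l)) (Ioi 0)) {p : ℝ × ℝ}
    (hp : p ∈ Ioi (0 : ℝ) ×ˢ Ioi (0 : ℝ)) :
    HasFDerivAt (profileIntegral h ψ)
      (profileIntegral h' ψ p • ContinuousLinearMap.fst ℝ ℝ ℝ +
        profileIntegral h' (fun l => l * ψ l) p • ContinuousLinearMap.snd ℝ ℝ ℝ) p := by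
  have hh : Continuous h := continuous_iff_continuousAt.2 fun z => (hd z).continuousAt
  have hψ' : AEStronglyMeasurable (fun l => l * ψ l) (volume.restrict (Ioi 0)) :=
    continuous_id.aestronglyMeasurable.mul hψ
  have hm : 0 < min 1 (p.2 / 2) := lt_min one_pos (half_pos hp.2)
  have key := hasFDerivAt_integral_of_dominated_of_fderiv_le (𝕜 := ℝ)
    (μ := volume.restrict (Ioi (0 : ℝ))) (x₀ := p)
    (F := fun (q : ℝ × ℝ) l => ψ l * h (q.1 + l * q.2))
    (F' := fun q l => (ψ l * h' (q.1 + l * q.2)) • ContinuousLinearMap.fst ℝ ℝ ℝ +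
      (l * ψ l * h' (q.1 + l * q.2)) • ContinuousLinearMap.snd ℝ ℝ ℝ)
    (bound := fun l => C' * min 1 (p.2 / 2) ^ (-α) * ‖(1 + l) ^ (-α) * ψ l‖ +
      C' * min 1 (p.2 / 2) ^ (-α) * ‖(1 + l) ^ (-α) * (l * ψ l)‖)
    (eventually_nonneg_and_min_le hp)
    (Filter.Eventually.of_forall fun q => aestronglyMeasurable_mul_profile hh hψ q)
    (integrableOn_mul_profile hh hψ hβ hb hi hp)
    (((aestronglyMeasurable_mul_profile hh' hψ p).smul_const _).add
      ((aestronglyMeasurable_mul_profile hh' hψ' p).smul_const _))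
    ((ae_restrict_mem measurableSet_Ioi).mono fun l hl q hq => ?_)
    ((hi'.norm.const_mul _).add (hi''.norm.const_mul _))
    (Filter.Eventually.of_forall fun l q _ => ?_)
  · refine key.congr_fderiv ?_
    rw [integral_add, integral_smul_const, integral_smul_const]
    · rfl
    · exact (integrableOn_mul_profile hh' hψ hα hb' hi' hp).smul_const _
    · exact (integrableOn_mul_profile hh' hψ' hα hb' hi'' hp).smul_const _
  · refine (norm_add_le _ _).trans (add_le_add ?_ ?_)
    · rw [norm_smul]
      exact (mul_le_of_le_one_right (norm_nonneg _) (ContinuousLinearMap.norm_fst_le ℝ ℝ ℝ)).trans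
        (norm_mul_profile_le hα hb' hm (min_le_left _ _) hq.1 hq.2 (le_of_lt hl))
    · rw [norm_smul]
      exact (mul_le_of_le_one_right (norm_nonneg _) (ContinuousLinearMap.norm_snd_le ℝ ℝ ℝ)).trans
        (norm_mul_profile_le (ψ := fun l => l * ψ l) hα hb' hm (min_le_left _ _) hq.1 hq.2
          (le_of_lt hl))
  · have h1 : HasFDerivAt (fun q : ℝ × ℝ => q.1 + l * q.2)
        (ContinuousLinearMap.fst ℝ ℝ ℝ + l • ContinuousLinearMap.snd ℝ ℝ ℝ) q :=
      hasFDerivAt_fst.add (hasFDerivAt_snd.const_mul l)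
    have h2 := ((hd (q.1 + l * q.2)).comp_hasFDerivAt q h1).const_mul (ψ l)
    refine h2.congr_fderiv ?_
    ext
    · simp
    · simp
      ring

lemma contDiffOn_succ_of_hasFDerivAt {U : Set (ℝ × ℝ)} (hU : IsOpen U) {n : ℕ}
    {Ψ a b : ℝ × ℝ → ℝ} (hΨ : ∀ p ∈ U, HasFDerivAt Ψ
      (a p • ContinuousLinearMap.fst ℝ ℝ ℝ + b p • ContinuousLinearMap.snd ℝ ℝ ℝ) p)
    (ha : ContDiffOn ℝ n a U) (hb : ContDiffOn ℝ n b U) : ContDiffOn ℝ (n + 1) Ψ U := by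
  rw [contDiffOn_succ_iff_fderiv_of_isOpen hU]
  refine ⟨fun p hp => (hΨ p hp).differentiableAt.differentiableWithinAt, by simp, ?_⟩
  exact ((ha.smul contDiffOn_const).add (hb.smul contDiffOn_const)).congr
    fun p hp => (hΨ p hp).fderiv

end Profile

section Regularity

variable {φ : ℝ → ℝ}

lemma integrableOn_one_add_rpow_mul (hloc : IntegrableOn φ (Ioc 0 1))
    (h : IntegrableOn (fun l => l ^ (3 / 4 : ℝ) * φ l) (Ioi 0)) :
    IntegrableOn (fun l => (1 + l) ^ (3 / 4 : ℝ) * φ l) (Ioi 0) := by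
  have hm : Measurable fun l : ℝ => (1 + l) ^ (3 / 4 : ℝ) := by fun_prop
  have hinv : Measurable fun l : ℝ => (l ^ (3 / 4 : ℝ))⁻¹ := by fun_prop
  have hfar := h.mono_set (Ioi_subset_Ioi zero_le_one)
  rw [← Ioc_union_Ioi_eq_Ioi (zero_le_one : (0 : ℝ) ≤ 1)]
  refine IntegrableOn.union ?_ ?_
  · refine (hloc.norm.const_mul (2 ^ (3 / 4 : ℝ))).mono' (hm.aestronglyMeasurable.mul hloc.1) ?_
    refine (ae_restrict_mem measurableSet_Ioc).mono fun l hl => ?_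
    have hl0 : 0 ≤ 1 + l := by linarith [hl.1]
    rw [norm_mul, Real.norm_of_nonneg (Real.rpow_nonneg hl0 _)]
    gcongr
    linarith [hl.2]
  · have hφm : AEStronglyMeasurable φ (volume.restrict (Ioi 1)) := by
      refine (hinv.aestronglyMeasurable.mul hfar.1).congr ?_
      refine (ae_restrict_mem measurableSet_Ioi).mono fun l hl => ?_
      have hl0 : 0 < l := zero_lt_one.trans hl
      have : l ^ (3 / 4 : ℝ) ≠ 0 := by positivity
      simp only [Pi.mul_apply]
      rw [inv_mul_cancel_left₀ this]
    refine (hfar.norm.const_mul (2 ^ (3 / 4 : ℝ))).mono' (hm.aestronglyMeasurable.mul hφm) ?_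
    refine (ae_restrict_mem measurableSet_Ioi).mono fun l hl => ?_
    have hl1 : 1 < l := hl
    have hl0 : 0 < l := by linarith
    have hl2 : 0 ≤ 1 + l := by linarith
    rw [norm_mul, norm_mul, Real.norm_of_nonneg (Real.rpow_nonneg hl2 _),
      Real.norm_of_nonneg (Real.rpow_nonneg hl0.le _), ← mul_assoc, ← Real.mul_rpow zero_le_two hl0.le]
    gcongr
    linarith

lemma integrableOn_rpow_mul_pow_mul (hφ : AEStronglyMeasurable φ (volume.restrict (Ioi 0)))
    (h : IntegrableOn (fun l => (1 + l) ^ (3 / 4 : ℝ) * φ l) (Ioi 0)) {a : ℝ} (k : ℕ)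
    (hak : a + k ≤ 3 / 4) :
    IntegrableOn (fun l => (1 + l) ^ a * (l ^ k * φ l)) (Ioi 0) := by
  have hm : Measurable fun l : ℝ => (1 + l) ^ a := by fun_prop
  refine h.norm.mono' (hm.aestronglyMeasurable.mul
    ((continuous_pow k).aestronglyMeasurable.mul hφ)) ?_
  refine (ae_restrict_mem measurableSet_Ioi).mono fun l hl => ?_
  have hl0 : 0 < l := hl
  have h1 : 0 < 1 + l := by linarith
  rw [norm_mul, norm_mul, norm_mul, ← mul_assoc, Real.norm_of_nonneg (Real.rpow_nonneg h1.le a),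
    Real.norm_of_nonneg (Real.rpow_nonneg h1.le _), Real.norm_of_nonneg (pow_nonneg hl0.le k)]
  gcongr
  calc (1 + l) ^ a * l ^ k ≤ (1 + l) ^ a * (1 + l) ^ k := by gcongr; linarith
    _ = (1 + l) ^ (a + k) := by rw [Real.rpow_add h1, Real.rpow_natCast]
    _ ≤ _ := Real.rpow_le_rpow_of_exponent_le (by linarith) hak

/-- The second derivatives of `J₀(√(y² + 2 l y e^t))` grow like `l² l ^ (-5/4) = l ^ (3/4)`. -/
lemma contDiffOn_profileIntegral (hφ : AEStronglyMeasurable φ (volume.restrict (Ioi 0)))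
    (h : IntegrableOn (fun l => (1 + l) ^ (3 / 4 : ℝ) * φ l) (Ioi 0)) :
    ContDiffOn ℝ 2 (profileIntegral (besselEntire 0) φ) (Ioi 0 ×ˢ Ioi 0) := by
  obtain ⟨C₀, -, hb₀⟩ := exists_besselEntire_zero_bound
  obtain ⟨C₁, -, hb₁⟩ := exists_besselEntire_one_bound
  obtain ⟨C₂, -, hb₂⟩ := exists_besselEntire_two_bound
  have hU : IsOpen (Ioi (0 : ℝ) ×ˢ Ioi (0 : ℝ)) := isOpen_Ioi.prod isOpen_Ioi
  have hI : ∀ (a : ℝ) (k : ℕ), a + k ≤ 3 / 4 →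
      IntegrableOn (fun l => (1 + l) ^ a * (l ^ k * φ l)) (Ioi 0) := fun a k hak =>
    integrableOn_rpow_mul_pow_mul hφ h k hak
  have hmk : ∀ k : ℕ, AEStronglyMeasurable (fun l => l ^ k * φ l) (volume.restrict (Ioi 0)) :=
    fun k => (continuous_pow k).aestronglyMeasurable.mul hφ
  have hsucc : ∀ k : ℕ, (fun l => l * (l ^ k * φ l)) = fun l => l ^ (k + 1) * φ l := fun k => by
    funext l; ring
  have hneg : ∀ {n : ℕ} {C α : ℝ}, (∀ z, 0 ≤ z → |besselEntire n z| ≤ C * (1 + z) ^ (-α)) →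
      ∀ z, 0 ≤ z → |-(besselEntire n z) / 4| ≤ C * (1 + z) ^ (-α) := fun hb z hz => by
    rw [abs_div, abs_neg, abs_of_pos (by norm_num : (0 : ℝ) < 4)]
    refine le_trans ?_ (hb z hz)
    exact div_le_self (abs_nonneg _) (by norm_num)
  have hscale : ∀ (n : ℕ) (ψ : ℝ → ℝ), profileIntegral (fun z => -(besselEntire n z) / 4) ψ =
      fun p => -1 / 4 * profileIntegral (besselEntire n) ψ p := fun n ψ => by
    funext p
    rw [profileIntegral, profileIntegral, ← integral_const_mul]
    congr 1
    funext l
    ring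
  have h2 : ∀ k : ℕ, k ≤ 2 → ContDiffOn ℝ (0 : ℕ) (profileIntegral (fun z => -(besselEntire 2 z) / 4)
      (fun l => l ^ k * φ l)) (Ioi 0 ×ˢ Ioi 0) := fun k hk => by
    have hk' : (k : ℝ) ≤ 2 := by exact_mod_cast hk
    exact contDiffOn_zero.2 (continuousOn_profileIntegral ((continuous_besselEntire 2).neg.div_const 4)
      (hmk k) (by norm_num : (0 : ℝ) ≤ 5 / 4) (hneg hb₂) (hI _ k (by linarith)))
  have h1 : ∀ k : ℕ, k ≤ 1 → ContDiffOn ℝ (1 : ℕ) (profileIntegral (fun z => -(besselEntire 1 z) / 4)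
      (fun l => l ^ k * φ l)) (Ioi 0 ×ˢ Ioi 0) := fun k hk => by
    have hk' : (k : ℝ) ≤ 1 := by exact_mod_cast hk
    have hd := fun (p : ℝ × ℝ) (hp : p ∈ Ioi (0 : ℝ) ×ˢ Ioi (0 : ℝ)) =>
      hasFDerivAt_profileIntegral (hasDerivAt_besselEntire 1)
      ((continuous_besselEntire 2).neg.div_const 4) (hmk k) (by norm_num : (0 : ℝ) ≤ 3 / 4)
      (by norm_num : (0 : ℝ) ≤ 5 / 4) hb₁ (hneg hb₂) (hI _ k (by linarith)) (hI _ k (by linarith))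
      ((hI (-(5 / 4)) (k + 1) (by push_cast; linarith)).congr_fun (fun l _ => by ring) measurableSet_Ioi) hp
    rw [hsucc] at hd
    rw [hscale]
    have := contDiffOn_succ_of_hasFDerivAt hU hd (h2 k (by omega)) (h2 (k + 1) (by omega))
    exact contDiffOn_const.mul (by exact_mod_cast this)
  have hd := fun (p : ℝ × ℝ) (hp : p ∈ Ioi (0 : ℝ) ×ˢ Ioi (0 : ℝ)) =>
    hasFDerivAt_profileIntegral (hasDerivAt_besselEntire 0)
    ((continuous_besselEntire 1).neg.div_const 4) (hmk 0) (by norm_num : (0 : ℝ) ≤ 1 / 4)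
    (by norm_num : (0 : ℝ) ≤ 3 / 4) hb₀ (hneg hb₁) (hI _ 0 (by norm_num)) (hI _ 0 (by norm_num))
    ((hI (-(3 / 4)) (0 + 1) (by norm_num)).congr_fun (fun l _ => by ring) measurableSet_Ioi) hp
  rw [hsucc] at hd
  have := contDiffOn_succ_of_hasFDerivAt hU hd (h1 0 (by omega)) (h1 (0 + 1) (by omega))
  simp only [pow_zero, one_mul] at this
  exact_mod_cast this

lemma contDiffOn_besselSolution (hφ : AEStronglyMeasurable φ (volume.restrict (Ioi 0)))
    (h : IntegrableOn (fun l => (1 + l) ^ (3 / 4 : ℝ) * φ l) (Ioi 0)) :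
    ContDiffOn ℝ 2 (fun p : ℝ × ℝ => besselSolution φ p.1 p.2) (Ioi 0 ×ˢ univ) := by
  obtain ⟨C₀, -, hb₀⟩ := exists_besselEntire_zero_bound
  have hΨ := contDiffOn_profileIntegral hφ h
  have hI : IntegrableOn (fun l => (1 + l) ^ (-(1 / 4) : ℝ) * φ l) (Ioi 0) := by
    simpa using integrableOn_rpow_mul_pow_mul hφ h (a := -(1 / 4)) 0 (by norm_num)
  have hmap : ∀ σ : ℝ, MapsTo (fun p : ℝ × ℝ => (p.1 ^ 2, 2 * p.1 * Real.exp (σ * p.2)))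
      (Ioi 0 ×ˢ univ) (Ioi 0 ×ˢ Ioi 0) := fun σ p hp => by
    have : 0 < p.1 := hp.1
    exact ⟨by simp only [mem_Ioi]; positivity, by simp only [mem_Ioi]; positivity⟩
  have hc : ∀ σ : ℝ, ContDiffOn ℝ 2 (fun p : ℝ × ℝ => profileIntegral (besselEntire 0) φ
      (p.1 ^ 2, 2 * p.1 * Real.exp (σ * p.2))) (Ioi 0 ×ˢ univ) := fun σ =>
    hΨ.comp (ContDiff.contDiffOn (by fun_prop)) (hmap σ)
  refine (contDiffOn_const.mul ((hc 1).add (hc (-1)))).congr (f := fun p : ℝ × ℝ => (1 / 2 : ℝ) *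
    (profileIntegral (besselEntire 0) φ (p.1 ^ 2, 2 * p.1 * Real.exp (1 * p.2)) +
    profileIntegral (besselEntire 0) φ (p.1 ^ 2, 2 * p.1 * Real.exp (-1 * p.2)))) fun p hp => ?_
  have hint := fun σ => integrableOn_mul_profile (continuous_besselEntire 0) hφ
    (by norm_num : (0 : ℝ) ≤ 1 / 4) hb₀ hI (hmap σ hp)
  simp only [profileIntegral]
  rw [besselSolution_eq φ hp.1, ← integral_add (hint 1) (hint (-1))]
  congr 2
  funext l
  simp only [besselWave, one_mul, neg_one_mul, mul_add]

end Regularity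

theorem proposition4p1 (f φ : ℝ → ℝ) (s₀ : ℝ)
    (hf : ContinuousOn f (Ioi 0))
    (hF : ∀ s > s₀, LaplaceConverges f s)
    (hφ : IsInverseLaplaceOn φ
      (fun ξ => 1 / 2 * (ξ + 1 / ξ) * laplaceTransform f (1 / 2 * (1 / ξ - ξ)))
      {ξ | 0 < ξ ∧ s₀ < 1 / 2 * (1 / ξ - ξ)})
    (hconv : ∀ y > 0, ∀ t ≥ 0, IntegrableOn (fun l => φ l * besselKernel y t l) (Ioi 0)) :
    IsWeakSolution f (fun _ => 0) (besselSolution φ) ∧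
    (ContDiffOn ℝ 2 (fun p : ℝ × ℝ => besselSolution φ p.1 p.2) (Ioi 0 ×ˢ univ) →
      IsClassicalSolution f (fun _ => 0) (besselSolution φ)) ∧
    (IntegrableOn (fun l => l ^ (3 / 4 : ℝ) * φ l) (Ioi 0) →
      IsClassicalSolution f (fun _ => 0) (besselSolution φ)) := by
  obtain ⟨ξ, hξ, hξφ⟩ := exists_laplaceConverges_of_isInverseLaplaceOn hφ
  have hφm := aestronglyMeasurable_of_laplaceConverges hξφ
  have hloc := integrableOn_Ioc_of_laplaceConverges hξ hξφ
  have hw : IntegrableOn (fun l => (1 + l) ^ (-(1 / 4) : ℝ) * φ l) (Ioi 0) := by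
    refine integrableOn_rpow_mul_of_integrableOn_bessel hφm (hloc 64) fun y hy => ?_
    refine ((hconv y hy 0 le_rfl).const_mul (1 / 2)).congr ?_
    refine (ae_restrict_mem measurableSet_Ioi).mono fun l hl => ?_
    simp only [besselKernel_zero_right hy (le_of_lt hl)]
    ring
  have hinit : ∀ y > 0, besselSolution φ y 0 = f y := fun y hy =>
    besselSolution_zero_eq hf hF hφ hφm hw hy
  have hclassical : ContDiffOn ℝ 2 (fun p : ℝ × ℝ => besselSolution φ p.1 p.2) (Ioi 0 ×ˢ univ) →
      IsClassicalSolution f (fun _ => 0) (besselSolution φ) := fun hu => by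
    refine ⟨hu, fun y hy t => ?_, hinit, fun y hy => ?_⟩
    · exact sub_eq_zero.1 (waveOperator_eq_zero_of_weak hu (besselSolution_neg φ)
        (fun η hη hc hs => besselSolution_weak_equation hφm hw hη hc hs) hy t)
    · have hd := (hasDerivAt_snd_slice (p := (y, 0)) ((hu.differentiableOn
        two_ne_zero).differentiableAt (isOpen_halfPlane.mem_nhds ⟨hy, mem_univ _⟩))).differentiableAt
      have := hd.hasDerivAt
      rwa [deriv_zero_of_even (besselSolution_neg φ y)] at this
  refine ⟨⟨fun p hp => (continuousAt_besselSolution hφm hw hp.1).continuousWithinAt, hinit,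
    fun η hη hc hs => ?_⟩, hclassical, fun h => hclassical
      (contDiffOn_besselSolution hφm (integrableOn_one_add_rpow_mul (hloc 1) h))⟩
  refine (besselSolution_weak_equation hφm hw (contDiff_infty.1 hη 2) hc hs).trans ?_
  rw [← integral_neg]
  refine setIntegral_congr_fun measurableSet_Ioi fun y hy => ?_
  simp only [hinit y hy, zero_mul, zero_sub]
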